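/- Consider the $M_t|M_t|S$ queue with catastrophes. Let $\lambda,\mu,\xi:[0,\infty)\to[0,\infty)$ be locally integrable, let $\zeta_k$ ($k\ge1$) be real numbers with $\zeta=\inf_{k\ge1}\zeta_k>0$, and put $\lambda_k(t)=\lambda(t)$, $\mu_k(t)=\min(k,S)\,\mu(t)$, $\xi_k(t)=\zeta_k\,\xi(t)$. Let $A(t)=(a_{ik}(t))_{i,k\ge0}$ be the transposed intensity matrix of the queue-length process $X(t)$ on $\{0,1,2,\dots\}$: from state $k$ the process jumps to $k+1$ at rate $\lambda_k(t)$ and, if $k\ge1$, to $k-1$ at rate $\mu_k(t)$ and to $0$ at rate $\xi_k(t)$; $a_{ik}(t)$, $i\ne k$, is the total rate of jumps $k\to i$, and $a_{kk}(t)=-\sum_{i\ne k}a_{ik}(t)$. Suppose $|a_{kk}(t)|\le L<\infty$ for all $k$ and almost all $t\ge0$. For $n\ge1$ let $A_n(t)$ be the intensity matrix (transposed, and extended by zero) of the truncated process $X_n$ on $\{0,\dots,n\}$, in which the jumps within $\{0,\dots,n\}$ keep their rates, the jumps out of $\{0,\dots,n\}$ are suppressed, and each diagonal entry makes its column sum to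 zero. Let $\mathbf p(t)$ and $\mathbf p_n(t)$ be the corresponding distributions, i.e. the solutions in $\ell^1$ of the forward Kolmogorov systems $d\mathbf p/dt=A(t)\mathbf p$ and $d\mathbf p_n/dt=A_n(t)\mathbf p_n$ (understood in integrated form), and let $E_{\mathbf p}(t)=\sum_k k\,p_k(t)$ and $E_{\mathbf p_n}(t)=\sum_k k\,(\mathbf p_n(t))_k$ be their means. Let $\varepsilon>0$ be such that $\int_0^\infty(\zeta\xi(t)-\varepsilon\lambda(t))\,dt=+\infty$, and let $M,a>0$ be such that $$e^{-\int_s^t(\zeta\xi(u)-\varepsilon\lambda(u))\,du}\le M e^{-a(t-s)}\qquad\text{for all }0\le s\le t.$$ Put $d_i=(1+\varepsilon)^i$ and $W_n=\inf_{k\ge n}\frac1k\sum_{i=n}^k d_i$. Then for all $n\ge1$, $j\ge0$, $t\ge0$ and the initial condition $\mathbf p(0)=\mathbf p_n(0)=\mathbf e_j$, the means are finite and $$\|\mathbf p(t)-\mathbf p_n(t)\|\le\frac{8Lt}{nW_n}\Bigl(Mj(1+\varepsilon)^{j+1}+\frac{LM(1+\varepsilon)}{a}\Bigr),$$ $$|E_{\mathbf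 p}(t)-E_{\mathbf p_n}(t)|\le\frac{3L(n+1)t}{nW_n}\Bigl(Mj(1+\varepsilon)^{j+1}+\frac{LM(1+\varepsilon)}{a}\Bigr),$$ where $\|\cdot\|$ is the $\ell^1$ norm. -/

import Mathlib

open Filter Topology MeasureTheory Set

noncomputable section

/-- Real sequences `x₀, x₁, …` with `‖x‖ = ∑ |xᵢ| < ∞`. -/
abbrev L1Seq : Type := lp (fun _ : ℕ => ℝ) 1

/-- The `j`-th unit vector `e_j`. -/
def unitVec (j : ℕ) : L1Seq := lp.single 1 j (1 : ℝ)

/-- The transposed intensity matrix of a birth-death-catastrophe chain on `{0, 1, 2, …}`: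
the entry `(i, j)`, `i ≠ j`, is the rate of the jump `j → i`. The jump `j → j + 1` has rate
`lam j`, and, for `j ≥ 1`, the service `j → j - 1` has rate `mu j` and the catastrophe `j → 0`
has rate `xi j` (for `j = 1` the two add up). Every column sums to zero. -/
def bdcMatrix (lam mu xi : ℕ → ℝ) : Matrix ℕ ℕ ℝ := fun i j =>
  if i = j then -(lam j + if j = 0 then 0 else mu j + xi j)
  else (if i = j + 1 then lam j else 0) + (if i + 1 = j then mu j else 0)
    + (if i = 0 then xi j else 0)

/-- The transposed intensity matrix `A(t)` of the `M_t|M_t|S` queue with catastrophes: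
`lam_k(t) = lam(t)`, `mu_k(t) = min(k, S) mu(t)`, `xi_k(t) = z_k xi(t)`. -/
def queueMatrix (S : ℕ) (lam mu xi : ℝ → ℝ) (z : ℕ → ℝ) (t : ℝ) : Matrix ℕ ℕ ℝ :=
  bdcMatrix (fun _ => lam t) (fun k => (min k S : ℕ) * mu t) (fun k => z k * xi t)

/-- The reduced intensity matrix on `{0, …, n}`, extended by zero: the jumps inside
`{0, …, n}` keep their rates, the jumps out of `{0, …, n}` are suppressed, and the diagonal makes
the columns sum to zero. -/
def truncMatrix (n : ℕ) (A : Matrix ℕ ℕ ℝ) : Matrix ℕ ℕ ℝ := fun i j =>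
  if n < i ∨ n < j then 0
  else if i = j then -∑ k ∈ (Finset.range (n + 1)).erase j, A k j
  else A i j

/-- `p` solves the Cauchy problem `dp/dt = A(t) p`, `p(0) = p0`, on `[0, ∞)` in `ℓ¹`. The
coefficients are merely locally integrable in time, so the equation is understood in its
integrated form, written in coordinates. -/
structure IsKolmogorovSolution (A : ℝ → Matrix ℕ ℕ ℝ) (p0 : L1Seq) (p : ℝ → L1Seq) : Prop where
  continuousOn : ContinuousOn p (Ici 0)
  initial : p 0 = p0
  intervalIntegrable : ∀ k : ℕ, ∀ t : ℝ, 0 ≤ t →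
    IntervalIntegrable (fun s => ∑' i : ℕ, A s k i * p s i) volume 0 t
  integral_eq : ∀ k : ℕ, ∀ t : ℝ, 0 ≤ t →
    p t k = p0 k + ∫ s in (0 : ℝ)..t, ∑' i : ℕ, A s k i * p s i

/-- The mean `∑ k x_k` of a distribution `x` on `{0, 1, 2, …}`. -/
def seqMean (x : L1Seq) : ℝ := ∑' k : ℕ, (k : ℝ) * x k

/-- `W_n = inf_{k ≥ n} (d_n + ⋯ + d_k) / k`. -/
def truncWeight (d : ℕ → ℝ) (n : ℕ) : ℝ :=
  ⨅ k : {k : ℕ // n ≤ k}, (∑ i ∈ Finset.Icc n (k : ℕ), d i) / ((k : ℕ) : ℝ)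

end

/-! Write g(k) = d_1 + ... + d_k, A for the full generator, q for the truncated distribution, and K
for the bracket in the claim.

Distribution. The difference p - q solves the equation of A with forcing (A - A_n) q. The flow of A
contracts ℓ¹, and A - A_n has nonzero columns only at i ≥ n, each of ℓ¹ norm at most 2L. So the
forcing is at most 2L P(X_n ≥ n), and since n W_n ≤ g(k) for k ≥ n, Markov's inequality bounds it by
2L/(n W_n) times the g-moment of q. A g-moment bound K uniform in time gives the distribution
estimate, with 2 in place of 8 (`norm_sub_le`, `truncation_error_le`).

Moment. A birth raises g by ε g + (1+ε), a service lowers it, a catastrophe resets it to 0. Hence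
the drift is at most (ελ - ζξ) g + (1+ε) λ, and Grönwall with the exponential decay hypothesis gives
K (`sum_geomWeight_le`). The truncated chain is again a birth-death-catastrophe chain, so the same
argument covers it when j ≤ n; when j > n it never leaves j.

Mean. Split at level n. The part up to n costs at most n ‖p - q‖. Above n, q keeps its initial value
e_j, so the remainder is the change of the tail mean of p, whose speed is at most L(n+1)/(n W_n) K
(`abs_tail_mean_sub_le`). -/

/-! ### Grönwall's inequality for absolutely continuous functions -/

/-- The exponential of an absolutely continuous function is absolutely continuous. -/
theorem AbsolutelyContinuousOnInterval.rexp {f : ℝ → ℝ} {a b : ℝ}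
    (hf : AbsolutelyContinuousOnInterval f a b) :
    AbsolutelyContinuousOnInterval (fun t => Real.exp (f t)) a b := by
  obtain ⟨K, hK⟩ := hf.exists_bound
  have hexp : ∀ x ∈ Icc (-K) K, ∀ y ∈ Icc (-K) K,
      dist (Real.exp x) (Real.exp y) ≤ Real.exp K * dist x y := by
    intro x hx y hy
    rw [dist_comm (Real.exp x), dist_comm x, dist_eq_norm, dist_eq_norm]
    refine Convex.norm_image_sub_le_of_norm_deriv_le (s := Icc (-K) K)
      (fun z _ => Real.differentiable_exp z) (fun z hz => ?_) (convex_Icc _ _) hx hy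
    rw [Real.deriv_exp, Real.norm_eq_abs, abs_of_pos (Real.exp_pos z)]
    exact Real.exp_le_exp.2 hz.2
  have hb : ∀ x ∈ uIcc a b, f x ∈ Icc (-K) K := fun x hx => abs_le.1 (hK x hx)
  unfold AbsolutelyContinuousOnInterval at hf ⊢
  refine squeeze_zero' (Eventually.of_forall fun E => Finset.sum_nonneg fun i _ => dist_nonneg) ?_
    (by simpa using hf.const_mul (Real.exp K))
  filter_upwards [mem_inf_of_right (mem_principal_self _)] with E hE
  rw [Finset.mul_sum]
  refine Finset.sum_le_sum fun i hi => hexp _ (hb _ ?_) _ (hb _ ?_)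
  · exact (hE.1 i hi).1
  · exact (hE.1 i hi).2

/-- Grönwall's inequality with integrable coefficients, for the integrated form of
`y' ≤ c y + b`. -/
theorem le_of_integral_eq_of_ae_le {y g c b : ℝ → ℝ} {T : ℝ} (hT : 0 ≤ T)
    (hg : IntervalIntegrable g volume 0 T) (hc : IntervalIntegrable c volume 0 T)
    (hb : IntervalIntegrable b volume 0 T)
    (hy : ∀ t ∈ Icc 0 T, y t = y 0 + ∫ s in (0 : ℝ)..t, g s)
    (hle : ∀ᵐ s ∂volume.restrict (Ioc 0 T), g s ≤ c s * y s + b s) :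
    y T ≤ Real.exp (∫ u in (0 : ℝ)..T, c u) * y 0
      + ∫ s in (0 : ℝ)..T, Real.exp (∫ u in s..T, c u) * b s := by
  -- Integrating factor normalised at T, so that U(T) = 1 and U(s) is the kernel of the conclusion.
  set U : ℝ → ℝ := fun s => Real.exp (-∫ u in T..s, c u) with hU
  -- y is controlled only on [0, T]; Y is a primitive defined everywhere, so its a.e. derivative is
  -- available.
  set Y : ℝ → ℝ := fun t => y 0 + ∫ s in (0 : ℝ)..t, g s with hY
  have hUe : ∀ s, Real.exp (∫ u in s..T, c u) = U s := fun s => by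
    rw [hU]; simp only; rw [intervalIntegral.integral_symm]
  have hCac := hc.absolutelyContinuousOnInterval_intervalIntegral (c := T) right_mem_uIcc
  have hUac : AbsolutelyContinuousOnInterval U 0 T := hCac.neg.rexp
  have hconst : AbsolutelyContinuousOnInterval (fun _ : ℝ => y 0) 0 T := by
    have : LipschitzOnWith 0 (fun _ : ℝ => y 0) (uIcc 0 T) :=
      (LipschitzWith.const (y 0)).lipschitzOnWith
    exact this.absolutelyContinuousOnInterval
  have hYac : AbsolutelyContinuousOnInterval Y 0 T :=
    hconst.add (hg.absolutelyContinuousOnInterval_intervalIntegral left_mem_uIcc)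
  have key := hUac.integral_deriv_mul_eq_sub hYac
  have hder : ∀ᵐ x : ℝ, x ∈ uIcc 0 T →
      deriv U x = -(c x) * U x ∧ deriv Y x = g x := by
    filter_upwards [hc.ae_hasDerivAt_integral, hg.ae_hasDerivAt_integral] with x h1 h2 hx
    constructor
    · have := ((h1 hx T right_mem_uIcc).neg.exp).deriv
      rw [hU]; simp only [Pi.neg_apply] at this ⊢
      rw [mul_comm]; exact this
    · have := ((h2 hx 0 left_mem_uIcc).const_add (y 0)).deriv
      exact this
  have hmono : ∫ x in (0 : ℝ)..T, deriv U x * Y x + U x * deriv Y x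
      ≤ ∫ s in (0 : ℝ)..T, U s * b s := by
    refine intervalIntegral.integral_mono_ae_restrict hT ?_ ?_ ?_
    · exact (hUac.intervalIntegrable_deriv.mul_continuousOn hYac.continuousOn).add
        (hYac.intervalIntegrable_deriv.continuousOn_mul hUac.continuousOn)
    · exact hb.continuousOn_mul hUac.continuousOn
    · rw [← restrict_Ioc_eq_restrict_Icc]
      filter_upwards [hle, ae_restrict_of_ae hder, ae_restrict_mem measurableSet_Ioc]
        with s h1 h2 hs
      have hs' : s ∈ Icc 0 T := Ioc_subset_Icc_self hs
      obtain ⟨e1, e2⟩ := h2 (by rwa [uIcc_of_le hT])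
      rw [e1, e2]
      have : Y s = y s := (hy s hs').symm
      rw [this]
      have : 0 ≤ U s := (Real.exp_pos _).le
      nlinarith [mul_le_mul_of_nonneg_left h1 this]
  rw [key] at hmono
  have h0 : Y 0 = y 0 := by simp [hY]
  have hT1 : Y T = y T := (hy T (right_mem_Icc.2 hT)).symm
  have hUT : U T = 1 := by simp [hU]
  simp only [hUe]
  rw [h0, hT1, hUT] at hmono
  linarith

/-! ### Growth of curves in ℓ¹ -/

theorem abs_le_norm_sum (x : L1Seq) (F : Finset ℕ) : ∑ k ∈ F, |x k| ≤ ‖x‖ := by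
  have := lp.sum_rpow_le_norm_rpow (p := 1) (by simp) x F
  simpa using this

theorem norm_le_of_forall_sum_abs_le {x : L1Seq} {C : ℝ} (hC : 0 ≤ C)
    (h : ∀ F : Finset ℕ, ∑ k ∈ F, |x k| ≤ C) : ‖x‖ ≤ C := by
  refine lp.norm_le_of_forall_sum_le (p := 1) (by simp) hC fun F => ?_
  simpa using h F

theorem summable_abs (x : L1Seq) : Summable fun k => |x k| := by
  simpa using (lp.memℓp x).summable (by simp)

/-- A curve in `ℓ¹` whose coordinates satisfy `q_k' = -L q_k + h_k` with
`∑ |h_k| ≤ L ‖q‖ + β` grows at most linearly. -/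
theorem norm_le_add_mul_of_dissipative {q : ℝ → L1Seq} {g : ℕ → ℝ → ℝ} {L β T : ℝ} (hT : 0 ≤ T)
    (hL : 0 ≤ L) (hβ : 0 ≤ β) (hq : ContinuousOn q (Icc 0 T))
    (hg : ∀ k, IntervalIntegrable (g k) volume 0 T)
    (hqg : ∀ k, ∀ t ∈ Icc 0 T, q t k = q 0 k + ∫ s in (0 : ℝ)..t, g k s)
    (hle : ∀ᵐ s ∂volume.restrict (Ioc 0 T), ∀ F : Finset ℕ,
      ∑ k ∈ F, |g k s + L * q s k| ≤ L * ‖q s‖ + β) :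
    ‖q T‖ ≤ ‖q 0‖ + β * T := by
  have hqk : ∀ k, ContinuousOn (fun s => q s k) (Icc 0 T) := fun k =>
    ((lp.evalCLM ℝ (fun _ : ℕ => ℝ) 1 k).continuous.comp_continuousOn hq)
  have hh : ∀ k, IntervalIntegrable (fun s => |g k s + L * q s k|) volume 0 T := fun k =>
    ((hg k).add (((hqk k).intervalIntegrable_of_Icc hT).const_mul L)).abs
  have hG : ContinuousOn (fun s => Real.exp (L * s) * (L * ‖q s‖ + β)) (Icc 0 T) := by
    have := hq.norm
    fun_prop
  have hsub : ∀ t ∈ Icc 0 T, uIcc 0 t ⊆ uIcc 0 T := fun t ht => by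
    rw [uIcc_of_le ht.1, uIcc_of_le hT]; exact Icc_subset_Icc_right ht.2
  -- Grönwall with c = -L, applied to both q_k and -q_k, bounds |q_k|; summing over finite sets of
  -- coordinates brings in the norm.
  have step : ∀ t ∈ Icc 0 T, Real.exp (L * t) * ‖q t‖
      ≤ ‖q 0‖ + ∫ s in (0 : ℝ)..t, Real.exp (L * s) * (L * ‖q s‖ + β) := by
    intro t ht
    have hres : volume.restrict (Ioc 0 t) ≤ volume.restrict (Ioc 0 T) :=
      Measure.restrict_mono (Ioc_subset_Ioc_right ht.2) le_rfl
    have coord : ∀ k, Real.exp (L * t) * |q t k|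
        ≤ |q 0 k| + ∫ s in (0 : ℝ)..t, Real.exp (L * s) * |g k s + L * q s k| := by
      intro k
      have hgt := (hg k).mono_set (hsub t ht)
      have hht := (hh k).mono_set (hsub t ht)
      have h1 := le_of_integral_eq_of_ae_le (y := fun s => q s k) (c := fun _ => -L) ht.1 hgt
        (by simp) hht (fun s hs => hqg k s ⟨hs.1, hs.2.trans ht.2⟩)
        (Eventually.of_forall fun s => by
          have := le_abs_self (g k s + L * q s k); linarith)
      have h2 := le_of_integral_eq_of_ae_le (y := fun s => -q s k) (c := fun _ => -L) ht.1 hgt.neg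
        (by simp) hht (fun s hs => by
          rw [hqg k s ⟨hs.1, hs.2.trans ht.2⟩]
          simp only [Pi.neg_apply, intervalIntegral.integral_neg]; ring)
        (Eventually.of_forall fun s => by
          have := neg_abs_le (g k s + L * q s k)
          simp only [Pi.neg_apply]; linarith)
      simp only [intervalIntegral.integral_const, smul_eq_mul, sub_zero] at h1 h2
      have hI : Real.exp (L * t) * ∫ s in (0 : ℝ)..t, Real.exp ((t - s) * -L) * |g k s + L * q s k|
          = ∫ s in (0 : ℝ)..t, Real.exp (L * s) * |g k s + L * q s k| := by
        rw [← intervalIntegral.integral_const_mul]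
        congr 1; ext s
        rw [← mul_assoc, ← Real.exp_add]; congr 2; ring
      have hE : Real.exp (L * t) * Real.exp (t * -L) = 1 := by
        rw [← Real.exp_add, ← Real.exp_zero]; congr 1; ring
      have hpos := Real.exp_pos (L * t)
      have h3 : |q t k| ≤ Real.exp (t * -L) * |q 0 k|
          + ∫ s in (0 : ℝ)..t, Real.exp ((t - s) * -L) * |g k s + L * q s k| := by
        have hp := (Real.exp_pos (t * -L)).le
        have a1 := mul_le_mul_of_nonneg_left (le_abs_self (q 0 k)) hp
        have a2 := mul_le_mul_of_nonneg_left (neg_le_abs (q 0 k)) hp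
        exact abs_le'.2 ⟨by linarith, by linarith⟩
      calc _ ≤ Real.exp (L * t) * (Real.exp (t * -L) * |q 0 k|
          + ∫ s in (0 : ℝ)..t, Real.exp ((t - s) * -L) * |g k s + L * q s k|) :=
            mul_le_mul_of_nonneg_left h3 hpos.le
        _ = _ := by rw [mul_add, hI, ← mul_assoc, hE, one_mul]
    have hpos := Real.exp_pos (L * t)
    have hint0 : ∀ k, IntervalIntegrable
        (fun s => Real.exp (L * s) * |g k s + L * q s k|) volume 0 t := fun k =>
      ((hh k).mono_set (hsub t ht)).continuousOn_mul (by fun_prop)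
    have hGt : IntervalIntegrable (fun s => Real.exp (L * s) * (L * ‖q s‖ + β)) volume 0 t :=
      ((hG.mono (Icc_subset_Icc_right ht.2)).intervalIntegrable_of_Icc ht.1)
    have hnn : 0 ≤ ∫ s in (0 : ℝ)..t, Real.exp (L * s) * (L * ‖q s‖ + β) :=
      intervalIntegral.integral_nonneg ht.1 fun s _ => by positivity
    rw [← le_div_iff₀' hpos]
    refine norm_le_of_forall_sum_abs_le (by positivity) fun F => ?_
    rw [le_div_iff₀' hpos, Finset.mul_sum]
    calc _ ≤ ∑ k ∈ F, (|q 0 k| + ∫ s in (0 : ℝ)..t, Real.exp (L * s) * |g k s + L * q s k|) :=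
          Finset.sum_le_sum fun k _ => coord k
      _ = ∑ k ∈ F, |q 0 k|
          + ∫ s in (0 : ℝ)..t, ∑ k ∈ F, Real.exp (L * s) * |g k s + L * q s k| := by
          rw [Finset.sum_add_distrib, intervalIntegral.integral_finsetSum fun k _ => hint0 k]
      _ ≤ _ := by
          refine add_le_add (abs_le_norm_sum _ _) ?_
          refine intervalIntegral.integral_mono_ae_restrict ht.1
            (by simpa only [Finset.sum_fn] using IntervalIntegrable.sum F fun k _ => hint0 k) hGt ?_
          rw [← restrict_Ioc_eq_restrict_Icc]
          filter_upwards [ae_mono hres hle] with s hs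
          rw [← Finset.mul_sum]
          exact mul_le_mul_of_nonneg_left (hs F) (Real.exp_pos _).le
  -- Second Grönwall, for the right side z of `step`: it satisfies z' ≤ L z + β e^{Ls}, so z(T) ≤
  -- e^{LT} (‖q(0)‖ + β T).
  have hfin := le_of_integral_eq_of_ae_le
    (y := fun t => ‖q 0‖ + ∫ s in (0 : ℝ)..t, Real.exp (L * s) * (L * ‖q s‖ + β))
    (c := fun _ => L) (b := fun s => Real.exp (L * s) * β) hT
    (hG.intervalIntegrable_of_Icc hT) (by simp)
    (Continuous.intervalIntegrable (by fun_prop) _ _) (fun t _ => by simp) (by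
      filter_upwards [ae_restrict_mem measurableSet_Ioc] with s hs
      have := mul_le_mul_of_nonneg_left (step s (Ioc_subset_Icc_self hs)) hL
      linarith)
  have hI : ∀ s : ℝ, Real.exp ((T - s) * L) * (Real.exp (L * s) * β) = Real.exp (L * T) * β := by
    intro s; rw [← mul_assoc, ← Real.exp_add]; congr 2; ring
  simp only [intervalIntegral.integral_const, smul_eq_mul, sub_zero, hI,
    intervalIntegral.integral_same, add_zero] at hfin
  have := (step T (right_mem_Icc.2 hT)).trans hfin
  rw [mul_comm T L] at this
  refine le_of_mul_le_mul_left ?_ (Real.exp_pos (L * T))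
  linarith

/-! ### Testing the forward equation against a function -/

section WeightedColumns

variable {B : Matrix ℕ ℕ ℝ} {f w x : ℕ → ℝ}

/-- Summing over k first leaves at most w_i |x_i|, so the double family is absolutely summable and
Fubini applies. -/
theorem summable_prod_of_column_bound
    (hw : ∀ i, ∀ F : Finset ℕ, ∑ k ∈ F, |f k| * |B k i| ≤ w i)
    (hx : Summable fun i => w i * |x i|) :
    Summable fun y : ℕ × ℕ => f y.2 * (B y.2 y.1 * x y.1) := by
  have hcol : ∀ i, Summable fun k => |f k| * |B k i| := fun i =>
    summable_of_sum_le (fun k => by positivity) (hw i)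
  refine Summable.of_norm ?_
  have hnorm : (fun y : ℕ × ℕ => ‖f y.2 * (B y.2 y.1 * x y.1)‖)
      = fun y : ℕ × ℕ => |f y.2| * |B y.2 y.1| * |x y.1| := by
    ext y; simp only [Real.norm_eq_abs, abs_mul]; ring
  rw [hnorm]
  refine (summable_prod_of_nonneg fun y => ?_).2 ⟨fun i => (hcol i).mul_right |x i|, ?_⟩
  · exact mul_nonneg (mul_nonneg (abs_nonneg _) (abs_nonneg _)) (abs_nonneg _)
  · have hle : ∀ i, ∑' k, |f k| * |B k i| * |x i| ≤ w i * |x i| := fun i => by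
      rw [tsum_mul_right]
      exact mul_le_mul_of_nonneg_right ((hcol i).tsum_le_of_sum_le (hw i)) (abs_nonneg _)
    exact Summable.of_nonneg_of_le (fun i => tsum_nonneg fun k =>
      mul_nonneg (mul_nonneg (abs_nonneg _) (abs_nonneg _)) (abs_nonneg _)) hle hx

/-- The duality ⟨f, Bx⟩ = ⟨Bᵀf, x⟩, which moves the generator onto the test function. -/
theorem tsum_column_comm
    (hw : ∀ i, ∀ F : Finset ℕ, ∑ k ∈ F, |f k| * |B k i| ≤ w i)
    (hx : Summable fun i => w i * |x i|) :
    HasSum (fun k => f k * ∑' i, B k i * x i) (∑' i, (∑' k, f k * B k i) * x i) := by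
  have hs := summable_prod_of_column_bound hw hx
  have h1 : (fun k => f k * ∑' i, B k i * x i) = fun k => ∑' i, f k * (B k i * x i) := by
    ext k; rw [tsum_mul_left]
  have h2 : (fun i => (∑' k, f k * B k i) * x i) = fun i => ∑' k, f k * (B k i * x i) := by
    ext i; rw [← tsum_mul_right]; simp only [mul_assoc]
  have hs' : Summable fun y : ℕ × ℕ => f y.1 * (B y.1 y.2 * x y.2) := hs.prod_symm
  rw [h1, h2, Summable.tsum_comm' (f := fun k i => f k * (B k i * x i)) hs'
    (fun k => hs'.prod_factor k) (fun i => hs.prod_factor i)]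
  exact hs'.prod.hasSum

theorem sum_abs_mul_tsum_le
    (hw : ∀ i, ∀ F : Finset ℕ, ∑ k ∈ F, |f k| * |B k i| ≤ w i)
    (hx : Summable fun i => w i * |x i|) (F : Finset ℕ) :
    ∑ k ∈ F, |f k * ∑' i, B k i * x i| ≤ ∑' i, w i * |x i| := by
  have hs := (summable_prod_of_column_bound hw hx).prod_symm
  have hrow : ∀ k, Summable fun i => |f k| * |B k i| * |x i| := fun k => by
    have := (hs.prod_factor k).norm
    refine this.congr fun i => ?_
    simp only [Prod.swap, Real.norm_eq_abs, abs_mul]; ring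
  calc ∑ k ∈ F, |f k * ∑' i, B k i * x i| ≤ ∑ k ∈ F, ∑' i, |f k| * |B k i| * |x i| := by
        refine Finset.sum_le_sum fun k _ => ?_
        rw [← tsum_mul_left, ← Real.norm_eq_abs]
        have e : (fun i => ‖f k * (B k i * x i)‖) = fun i => |f k| * |B k i| * |x i| := by
          ext i; simp only [Real.norm_eq_abs, abs_mul]; ring
        rw [← e]
        exact norm_tsum_le_tsum_norm (by rw [e]; exact hrow k)
    _ = ∑' i, ∑ k ∈ F, |f k| * |B k i| * |x i| :=
        (Summable.tsum_finsetSum fun k _ => hrow k).symm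
    _ ≤ ∑' i, w i * |x i| := by
        refine Summable.tsum_le_tsum (fun i => ?_) (summable_sum fun k _ => hrow k) hx
        rw [← Finset.sum_mul]
        exact mul_le_mul_of_nonneg_right (hw i F) (abs_nonneg _)

end WeightedColumns

/-- The forward equation tested against a function `f`, under an integrability condition
expressed through a weight `w` dominating the columns of `|f| |B|`. -/
theorem IsKolmogorovSolution.hasSum_test {B : ℝ → Matrix ℕ ℕ ℝ} {p0 : L1Seq} {p : ℝ → L1Seq}
    (hp : IsKolmogorovSolution B p0 p) {T : ℝ} (hT : 0 ≤ T) {f w : ℕ → ℝ} {C : ℝ}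
    (hw : ∀ᵐ s ∂volume.restrict (Ioc 0 T), ∀ i, ∀ F : Finset ℕ, ∑ k ∈ F, |f k| * |B s k i| ≤ w i)
    (hC : ∀ s ∈ Icc 0 T, (Summable fun i => w i * |p s i|) ∧ ∑' i, w i * |p s i| ≤ C) :
    IntervalIntegrable (fun s => ∑' i, (∑' k, f k * B s k i) * p s i) volume 0 T ∧
    HasSum (fun k => f k * p T k - f k * p0 k)
      (∫ s in (0 : ℝ)..T, ∑' i, (∑' k, f k * B s k i) * p s i) := by
  set G : ℕ → ℝ → ℝ := fun k s => f k * ∑' i, B s k i * p s i with hG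
  set D : ℝ → ℝ := fun s => ∑' i, (∑' k, f k * B s k i) * p s i with hD
  have hGint : ∀ k, IntegrableOn (G k) (Ioc 0 T) := fun k =>
    (intervalIntegrable_iff_integrableOn_Ioc_of_le hT).1
      ((hp.intervalIntegrable k T hT).const_mul (f k))
  -- The bound C on all finite sums, uniform in s, is what allows exchanging sum and time integral
  -- below.
  have hae : ∀ᵐ s ∂volume.restrict (Ioc 0 T), HasSum (fun k => G k s) (D s) ∧
      ∀ F : Finset ℕ, ∑ k ∈ F, |G k s| ≤ C := by
    filter_upwards [hw, ae_restrict_mem measurableSet_Ioc] with s hs hsT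
    have hc := hC s (Ioc_subset_Icc_self hsT)
    exact ⟨tsum_column_comm hs hc.1, fun F => (sum_abs_mul_tsum_le hs hc.1 F).trans hc.2⟩
  have hsumint : Summable fun k => ∫ s in Ioc 0 T, ‖G k s‖ := by
    refine summable_of_sum_le (c := ∫ _ in Ioc 0 T, C)
      (fun k => integral_nonneg fun s => norm_nonneg _) fun F => ?_
    rw [← integral_finsetSum _ fun k _ => (hGint k).norm]
    refine integral_mono_ae (integrable_finsetSum _ fun k _ => (hGint k).norm)
      (integrable_const _) ?_
    filter_upwards [hae] with s hs
    exact hs.2 F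
  have hsum := hasSum_integral_of_summable_integral_norm hGint hsumint
  have hDint : IntegrableOn D (Ioc 0 T) := by
    refine Integrable.of_bound (C := C) ?_ ?_
    · refine aestronglyMeasurable_of_tendsto_ae atTop
        (f := fun N s => ∑ k ∈ Finset.range N, G k s) (fun N => ?_) ?_
      · exact (integrable_finsetSum _ fun k _ => hGint k).aestronglyMeasurable
      · filter_upwards [hae] with s hs using hs.1.tendsto_sum_nat
    · filter_upwards [hae] with s hs
      refine le_of_tendsto' hs.1.tendsto_sum_nat.norm fun N => ?_
      exact (norm_sum_le _ _).trans (hs.2 _)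
  refine ⟨(intervalIntegrable_iff_integrableOn_Ioc_of_le hT).2 hDint, ?_⟩
  rw [intervalIntegral.integral_of_le hT]
  have e1 : ∫ s in Ioc 0 T, ∑' k, G k s = ∫ s in Ioc 0 T, D s :=
    integral_congr_ae (by filter_upwards [hae] with s hs using hs.1.tsum_eq)
  rw [← e1]
  refine hsum.congr_fun ?_
  intro k
  rw [hp.integral_eq k T hT, intervalIntegral.integral_of_le hT, hG]
  simp only
  rw [integral_const_mul]; ring

/-! ### The birth-death-catastrophe generator -/

/-- The total rate of the jumps out of state `i`. -/
def exitRate (lam mu xi : ℕ → ℝ) (i : ℕ) : ℝ := lam i + if i = 0 then 0 else mu i + xi i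

/-- The backward generator of the birth-death-catastrophe chain, applied to `f`. -/
def bdcDrift (lam mu xi f : ℕ → ℝ) (i : ℕ) : ℝ :=
  lam i * (f (i + 1) - f i)
    + if i = 0 then 0 else mu i * (f (i - 1) - f i) + xi i * (f 0 - f i)

/-- The rates are nonnegative and every exit rate is at most `L`. -/
structure IsBoundedRates (lam mu xi : ℕ → ℝ) (L : ℝ) : Prop where
  lam_nonneg : ∀ i, 0 ≤ lam i
  mu_nonneg : ∀ i, 1 ≤ i → 0 ≤ mu i
  xi_nonneg : ∀ i, 1 ≤ i → 0 ≤ xi i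
  exitRate_le : ∀ i, exitRate lam mu xi i ≤ L

theorem bdcMatrix_self (lam mu xi : ℕ → ℝ) (i : ℕ) :
    bdcMatrix lam mu xi i i = -exitRate lam mu xi i := by
  simp [bdcMatrix, exitRate]

/-- Each jump contributes its rate times (δ_target - δ_source). This form is linear in the rates and
needs no special case when service and catastrophe share the target 0. -/
theorem bdcMatrix_eq (lam mu xi : ℕ → ℝ) (k i : ℕ) :
    bdcMatrix lam mu xi k i =
      lam i * ((if k = i + 1 then 1 else 0) - if k = i then 1 else 0)
        + if i = 0 then 0 else
          mu i * ((if k = i - 1 then 1 else 0) - if k = i then 1 else 0)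
          + xi i * ((if k = 0 then 1 else 0) - if k = i then 1 else 0) := by
  unfold bdcMatrix
  rcases Nat.eq_zero_or_pos i with rfl | hi
  · by_cases h0 : k = 0
    · subst h0; simp
    · simp [h0]
  · have hi0 : i ≠ 0 := hi.ne'
    have hk : (k + 1 = i) = (k = i - 1) := by apply propext; omega
    simp only [hk]
    by_cases h : k = i
    · subst h
      have : k ≠ k - 1 := by omega
      simp [hi0, this]; ring
    · by_cases h1 : k = i + 1
      · subst h1
        have : i + 1 ≠ i - 1 := by omega
        simp [hi0, this]
      · simp [h, h1, hi0]

theorem hasSum_mul_bdcMatrix (lam mu xi f : ℕ → ℝ) (i : ℕ) :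
    HasSum (fun k => f k * bdcMatrix lam mu xi k i) (bdcDrift lam mu xi f i) := by
  have hd : ∀ m, HasSum (fun k => f k * if k = m then (1 : ℝ) else 0) (f m) := fun m => by
    have := hasSum_ite_eq m (f m)
    refine this.congr_fun fun k => ?_
    by_cases h : k = m <;> simp [h]
  have h1 := ((hd (i + 1)).sub (hd i)).mul_left (lam i)
  have h2 := (((hd (i - 1)).sub (hd i)).mul_left (mu i)).add
    (((hd 0).sub (hd i)).mul_left (xi i))
  unfold bdcDrift
  by_cases hi : i = 0
  · rw [if_pos hi, add_zero]
    refine h1.congr_fun fun k => ?_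
    rw [bdcMatrix_eq, if_pos hi]; ring
  · rw [if_neg hi]
    refine (h1.add h2).congr_fun fun k => ?_
    rw [bdcMatrix_eq, if_neg hi]; ring

theorem bdcDrift_const (lam mu xi : ℕ → ℝ) (c : ℝ) (i : ℕ) :
    bdcDrift lam mu xi (fun _ => c) i = 0 := by
  simp [bdcDrift]

namespace IsBoundedRates

variable {lam mu xi : ℕ → ℝ} {L : ℝ}

theorem le_exitRate (h : IsBoundedRates lam mu xi L) (i : ℕ) : lam i ≤ exitRate lam mu xi i := by
  unfold exitRate
  split_ifs with hi
  · simp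
  · have := h.mu_nonneg i (by omega)
    have := h.xi_nonneg i (by omega)
    linarith

theorem exitRate_nonneg (h : IsBoundedRates lam mu xi L) (i : ℕ) : 0 ≤ exitRate lam mu xi i :=
  (h.lam_nonneg i).trans (h.le_exitRate i)

theorem bound_nonneg (h : IsBoundedRates lam mu xi L) : 0 ≤ L :=
  (h.exitRate_nonneg 0).trans (h.exitRate_le 0)

theorem lam_le (h : IsBoundedRates lam mu xi L) (i : ℕ) : lam i ≤ L :=
  (h.le_exitRate i).trans (h.exitRate_le i)

theorem offDiag_nonneg (h : IsBoundedRates lam mu xi L) {k i : ℕ} (hki : k ≠ i) :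
    0 ≤ bdcMatrix lam mu xi k i := by
  unfold bdcMatrix
  rw [if_neg hki]
  have h1 := h.lam_nonneg i
  rcases Nat.eq_zero_or_pos i with rfl | hi
  · simp only [Nat.add_eq_zero_iff, one_ne_zero, and_false, if_false, hki, add_zero]
    split_ifs <;> simp [h1]
  · have h2 := h.mu_nonneg i hi
    have h3 := h.xi_nonneg i hi
    split_ifs <;> linarith

/-- Only the diagonal is negative, so absolute values add twice the exit rate there; weighted column
sums of |A| then reduce to the drift. -/
theorem abs_eq (h : IsBoundedRates lam mu xi L) (k i : ℕ) : |bdcMatrix lam mu xi k i|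
    = bdcMatrix lam mu xi k i + 2 * exitRate lam mu xi i * if k = i then 1 else 0 := by
  by_cases hki : k = i
  · subst hki
    rw [bdcMatrix_self, abs_neg, abs_of_nonneg (h.exitRate_nonneg k), if_pos rfl]; ring
  · rw [abs_of_nonneg (h.offDiag_nonneg hki), if_neg hki]; ring

theorem sum_mul_abs_le (h : IsBoundedRates lam mu xi L) {f : ℕ → ℝ} (hf : ∀ k, 0 ≤ f k)
    (i : ℕ) (F : Finset ℕ) :
    ∑ k ∈ F, |f k| * |bdcMatrix lam mu xi k i|
      ≤ bdcDrift lam mu xi f i + 2 * exitRate lam mu xi i * f i := by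
  have hs := (hasSum_mul_bdcMatrix lam mu xi f i).add
    (hasSum_ite_eq i (2 * exitRate lam mu xi i * f i))
  have hs' : HasSum (fun k => |f k| * |bdcMatrix lam mu xi k i|)
      (bdcDrift lam mu xi f i + 2 * exitRate lam mu xi i * f i) := by
    refine hs.congr_fun fun k => ?_
    rw [h.abs_eq, abs_of_nonneg (hf k)]
    by_cases hk : k = i
    · subst hk; simp; ring
    · simp [hk]
  exact sum_le_hasSum F (fun k _ => by positivity) hs'

theorem sum_abs_le (h : IsBoundedRates lam mu xi L) (i : ℕ) (F : Finset ℕ) :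
    ∑ k ∈ F, |bdcMatrix lam mu xi k i| ≤ 2 * exitRate lam mu xi i := by
  have := h.sum_mul_abs_le (f := fun _ => 1) (fun _ => zero_le_one) i F
  simpa [bdcDrift_const] using this

theorem summable_row (h : IsBoundedRates lam mu xi L) (x : L1Seq) (k : ℕ) :
    Summable fun i => bdcMatrix lam mu xi k i * x i := by
  refine Summable.of_norm_bounded ((summable_abs x).mul_left (2 * L)) fun i => ?_
  rw [Real.norm_eq_abs, abs_mul]
  refine mul_le_mul_of_nonneg_right ?_ (abs_nonneg _)
  have := h.sum_abs_le i {k}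
  rw [Finset.sum_singleton] at this
  linarith [h.exitRate_le i]

/-- A + L·I has nonnegative entries and column sums L, hence ℓ¹ operator norm at most L. -/
theorem dissipative (h : IsBoundedRates lam mu xi L) (x : L1Seq) (F : Finset ℕ) :
    ∑ k ∈ F, |(∑' i, bdcMatrix lam mu xi k i * x i) + L * x k| ≤ L * ‖x‖ := by
  have hL := h.bound_nonneg
  set B : Matrix ℕ ℕ ℝ := fun k i => bdcMatrix lam mu xi k i + if i = k then L else 0 with hB
  have hnn : ∀ k i, 0 ≤ B k i := fun k i => by
    simp only [hB]
    by_cases hik : i = k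
    · subst hik
      rw [bdcMatrix_self, if_pos rfl]
      linarith [h.exitRate_le i]
    · rw [if_neg hik, add_zero]
      exact h.offDiag_nonneg (Ne.symm hik)
  have hcol : ∀ i, ∀ F : Finset ℕ, ∑ k ∈ F, |(1 : ℝ)| * |B k i| ≤ L := fun i F => by
    have h1 := (hasSum_mul_bdcMatrix lam mu xi (fun _ => 1) i).add (hasSum_ite_eq i L)
    rw [bdcDrift_const, zero_add] at h1
    refine sum_le_hasSum F (fun k _ => by positivity) (h1.congr_fun fun k => ?_)
    rw [abs_of_nonneg (hnn k i)]
    simp [hB, eq_comm]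
  have hx : Summable fun i => L * |x i| := (summable_abs x).mul_left L
  have := sum_abs_mul_tsum_le (f := fun _ => 1) (x := x) hcol hx F
  rw [tsum_mul_left] at this
  have hn : ∑' i, |x i| ≤ ‖x‖ := (summable_abs x).tsum_le_of_sum_le (abs_le_norm_sum x)
  refine (le_of_eq ?_).trans (this.trans (mul_le_mul_of_nonneg_left hn hL))
  refine Finset.sum_congr rfl fun k _ => ?_
  have h2 := (h.summable_row x k).hasSum.add (hasSum_ite_eq k (L * x k))
  rw [← h2.tsum_eq, one_mul]
  congr 1
  refine tsum_congr fun i => ?_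
  by_cases hik : i = k
  · subst hik; simp [hB]; ring
  · simp [hB, hik]

end IsBoundedRates

/-! ### Perturbation, mass conservation and positivity -/

/-- Two solutions of forward equations stay as close as the perturbation of the generator
allows. -/
theorem IsKolmogorovSolution.norm_sub_le {lam mu xi : ℝ → ℕ → ℝ} {B : ℝ → Matrix ℕ ℕ ℝ}
    {p0 q0 : L1Seq} {p q : ℝ → L1Seq} {L β T : ℝ} {w : ℕ → ℝ}
    (hp : IsKolmogorovSolution (fun s => bdcMatrix (lam s) (mu s) (xi s)) p0 p)
    (hq : IsKolmogorovSolution B q0 q) (hT : 0 ≤ T) (hL : 0 ≤ L) (hβ : 0 ≤ β)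
    (hA : ∀ᵐ s ∂volume.restrict (Ioc 0 T), IsBoundedRates (lam s) (mu s) (xi s) L)
    (hw : ∀ᵐ s ∂volume.restrict (Ioc 0 T), ∀ i, ∀ F : Finset ℕ,
      ∑ k ∈ F, |bdcMatrix (lam s) (mu s) (xi s) k i - B s k i| ≤ w i)
    (hC : ∀ s ∈ Icc 0 T, (Summable fun i => w i * |q s i|) ∧ ∑' i, w i * |q s i| ≤ β) :
    ‖p T - q T‖ ≤ ‖p0 - q0‖ + β * T := by
  have hle : ∀ {t : ℝ}, t ∈ Icc 0 T → uIcc 0 t ⊆ uIcc 0 T := fun ht => by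
    rw [uIcc_of_le ht.1, uIcc_of_le hT]; exact Icc_subset_Icc_right ht.2
  have key := norm_le_add_mul_of_dissipative (q := fun s => p s - q s)
    (g := fun k s => ∑' i, bdcMatrix (lam s) (mu s) (xi s) k i * p s i - ∑' i, B s k i * q s i)
    (L := L) (β := β) hT hL hβ
    ((hp.continuousOn.sub hq.continuousOn).mono Icc_subset_Ici_self)
    (fun k => (hp.intervalIntegrable k T hT).sub (hq.intervalIntegrable k T hT))
    (fun k t ht => by
      rw [intervalIntegral.integral_sub (hp.intervalIntegrable k t ht.1)
        (hq.intervalIntegrable k t ht.1)]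
      simp only [lp.coeFn_sub, Pi.sub_apply]
      rw [hp.integral_eq k t ht.1, hq.integral_eq k t ht.1, hp.initial, hq.initial]
      ring) ?_
  · simpa only [hp.initial, hq.initial] using key
  filter_upwards [hA, hw, ae_restrict_mem measurableSet_Ioc] with s h1 h2 hs F
  obtain ⟨c1, c2⟩ := hC s (Ioc_subset_Icc_self hs)
  -- The right side splits as Ap - Bq = A(p - q) + (A - B)q: the first term is dissipative, the
  -- second is the forcing bounded by β.
  set A := bdcMatrix (lam s) (mu s) (xi s) with hAdef
  have hw' : ∀ i, ∀ F : Finset ℕ, ∑ k ∈ F, |(1 : ℝ)| * |(A - B s) k i| ≤ w i := fun i F => by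
    simpa using h2 i F
  have hrowD : ∀ k, Summable fun i => (A - B s) k i * q s i := fun k => by
    simpa using (summable_prod_of_column_bound (f := fun _ => 1) hw' c1).prod_symm.prod_factor k
  have h3 := sum_abs_mul_tsum_le (f := fun _ => 1) hw' c1 F
  have h4 := h1.dissipative (p s - q s) F
  refine le_trans ?_ (add_le_add h4 (h3.trans c2))
  rw [← Finset.sum_add_distrib]
  refine Finset.sum_le_sum fun k _ => ?_
  rw [one_mul]
  refine le_trans (le_of_eq ?_) (abs_add_le _ _)
  congr 1
  have e1 : ∑' i, A k i * (p s - q s) i = ∑' i, A k i * p s i - ∑' i, A k i * q s i := by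
    rw [← (h1.summable_row (p s) k).tsum_sub (h1.summable_row (q s) k)]
    exact tsum_congr fun i => by simp only [lp.coeFn_sub, Pi.sub_apply]; ring
  have e2 : ∑' i, B s k i * q s i = ∑' i, A k i * q s i - ∑' i, (A - B s) k i * q s i := by
    rw [← (h1.summable_row (q s) k).tsum_sub (hrowD k)]
    exact tsum_congr fun i => by simp only [Matrix.sub_apply]; ring
  rw [e1, e2]
  ring

theorem unitVec_apply (j k : ℕ) : unitVec j k = if k = j then 1 else 0 := by
  unfold unitVec
  rw [lp.coeFn_single]
  by_cases h : k = j
  · subst h; simp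
  · simp [h]

theorem norm_unitVec (j : ℕ) : ‖unitVec j‖ = 1 := by
  unfold unitVec
  rw [lp.norm_single (by simp)]
  simp

theorem norm_eq_tsum_abs (x : L1Seq) : ‖x‖ = ∑' k, |x k| :=
  le_antisymm (norm_le_of_forall_sum_abs_le (tsum_nonneg fun _ => abs_nonneg _) fun F =>
      (summable_abs x).sum_le_tsum F fun _ _ => abs_nonneg _)
    ((summable_abs x).tsum_le_of_sum_le (abs_le_norm_sum x))

/-- Comparison with this solution turns the perturbation estimate into the contraction bound ‖p(T)‖
≤ ‖p(0)‖. -/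
theorem isKolmogorovSolution_zero : IsKolmogorovSolution (fun _ => 0) 0 (fun _ => (0 : L1Seq)) where
  continuousOn := continuousOn_const
  initial := rfl
  intervalIntegrable k t _ := by simp
  integral_eq k t _ := by simp

section Distribution

variable {lam mu xi : ℝ → ℕ → ℝ} {p : ℝ → L1Seq} {L T : ℝ}

theorem IsKolmogorovSolution.norm_le {p0 : L1Seq}
    (hp : IsKolmogorovSolution (fun s => bdcMatrix (lam s) (mu s) (xi s)) p0 p) (hT : 0 ≤ T)
    (hL : 0 ≤ L)
    (hA : ∀ᵐ s ∂volume.restrict (Ioc 0 T), IsBoundedRates (lam s) (mu s) (xi s) L) :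
    ‖p T‖ ≤ ‖p0‖ := by
  have := hp.norm_sub_le isKolmogorovSolution_zero hT hL le_rfl hA (w := fun _ => 2 * L) (by
    filter_upwards [hA] with s hs i F
    have := hs.sum_abs_le i F
    have := hs.exitRate_le i
    simp only [Matrix.zero_apply, sub_zero]
    linarith) (by simp)
  simpa using this

/-- Solutions of the forward equation conserve the total mass. -/
theorem IsKolmogorovSolution.hasSum_one {j : ℕ}
    (hp : IsKolmogorovSolution (fun s => bdcMatrix (lam s) (mu s) (xi s)) (unitVec j) p)
    (hT : 0 ≤ T) (hL : 0 ≤ L)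
    (hA : ∀ᵐ s ∂volume.restrict (Ioc 0 T), IsBoundedRates (lam s) (mu s) (xi s) L) :
    HasSum (fun k => p T k) 1 := by
  have h := hp.hasSum_test hT (f := fun _ => 1) (w := fun _ => 2 * L) (C := 2 * L) (by
    filter_upwards [hA] with s hs i F
    have := hs.sum_abs_le i F
    have := hs.exitRate_le i
    simp only [abs_one, one_mul]
    linarith) (fun s hs => by
      refine ⟨(summable_abs _).mul_left _, ?_⟩
      rw [tsum_mul_left, ← norm_eq_tsum_abs]
      have hs' : Ioc 0 s ⊆ Ioc 0 T := Ioc_subset_Ioc_right hs.2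
      have := hp.norm_le hs.1 hL (ae_mono (Measure.restrict_mono hs' le_rfl) hA)
      rw [norm_unitVec] at this
      nlinarith)
  have h0 : ∫ s in (0 : ℝ)..T,
      ∑' i, (∑' k, (fun _ => (1 : ℝ)) k * bdcMatrix (lam s) (mu s) (xi s) k i) * p s i = 0 := by
    have : ∀ s i, ∑' k, (fun _ => (1 : ℝ)) k * bdcMatrix (lam s) (mu s) (xi s) k i = 0 := fun s i =>
      (hasSum_mul_bdcMatrix _ _ _ _ i).tsum_eq.trans (bdcDrift_const _ _ _ _ i)
    simp only [this]
    simp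
  rw [h0] at h
  have h1 := h.2.add (hasSum_ite_eq j (1 : ℝ))
  rw [zero_add] at h1
  refine h1.congr_fun fun k => ?_
  rw [unitVec_apply]; ring

/-- Total mass 1 and norm at most 1 force ∑ (|p_k| - p_k) ≤ 0 with nonnegative terms, so every term
vanishes. -/
theorem IsKolmogorovSolution.nonneg {j : ℕ}
    (hp : IsKolmogorovSolution (fun s => bdcMatrix (lam s) (mu s) (xi s)) (unitVec j) p)
    (hT : 0 ≤ T) (hL : 0 ≤ L)
    (hA : ∀ᵐ s ∂volume.restrict (Ioc 0 T), IsBoundedRates (lam s) (mu s) (xi s) L) (k : ℕ) :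
    0 ≤ p T k := by
  have h1 := hp.hasSum_one hT hL hA
  have h2 := hp.norm_le hT hL hA
  rw [norm_unitVec, norm_eq_tsum_abs] at h2
  have h3 := (summable_abs (p T)).hasSum.sub h1
  have h4 := le_hasSum h3 k fun i _ => sub_nonneg.2 (le_abs_self _)
  have h5 := abs_nonneg (p T k)
  linarith

end Distribution

/-! ### The exponential weight and the Lyapunov bound -/

/-- `d_1 + ⋯ + d_k` for `d_i = (1 + ε)^i`. -/
def geomWeight (ε : ℝ) (k : ℕ) : ℝ := ∑ i ∈ Finset.Icc 1 k, (1 + ε) ^ i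

theorem geomWeight_zero (ε : ℝ) : geomWeight ε 0 = 0 := by simp [geomWeight]

theorem geomWeight_succ (ε : ℝ) (k : ℕ) :
    geomWeight ε (k + 1) = geomWeight ε k + (1 + ε) ^ (k + 1) := by
  unfold geomWeight
  rw [Finset.sum_Icc_succ_top (by omega)]

/-- Expresses the increment through the weight itself, which closes the drift inequality. -/
theorem geomWeight_succ' (ε : ℝ) (k : ℕ) :
    geomWeight ε (k + 1) = geomWeight ε k + (ε * geomWeight ε k + (1 + ε)) := by
  induction k with
  | zero => simp [geomWeight]
  | succ k ih =>
    rw [geomWeight_succ ε (k + 1), pow_succ]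
    have h1 := geomWeight_succ ε k
    rw [ih] at h1 ⊢
    have h2 : (1 + ε) ^ (k + 1) = ε * geomWeight ε k + (1 + ε) := by linarith
    rw [h2]; ring

theorem geomWeight_mono {ε : ℝ} (hε : 0 ≤ ε) : Monotone (geomWeight ε) :=
  monotone_nat_of_le_succ fun k => by
    rw [geomWeight_succ]; exact le_add_of_nonneg_right (by positivity)

theorem geomWeight_nonneg {ε : ℝ} (hε : 0 ≤ ε) (k : ℕ) : 0 ≤ geomWeight ε k :=
  Finset.sum_nonneg fun i _ => by positivity

theorem le_geomWeight {ε : ℝ} (hε : 0 ≤ ε) (k : ℕ) : (k : ℝ) ≤ geomWeight ε k := by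
  induction k with
  | zero => simp [geomWeight]
  | succ k ih =>
    rw [geomWeight_succ]
    have : (1 : ℝ) ≤ (1 + ε) ^ (k + 1) := one_le_pow₀ (by linarith)
    push_cast; linarith

theorem geomWeight_le {ε : ℝ} (hε : 0 ≤ ε) (k : ℕ) :
    geomWeight ε k ≤ k * (1 + ε) ^ (k + 1) := by
  have : geomWeight ε k ≤ ∑ _i ∈ Finset.Icc 1 k, (1 + ε) ^ (k + 1) :=
    Finset.sum_le_sum fun i hi => pow_le_pow_right₀ (by linarith)
      (by have := (Finset.mem_Icc.1 hi).2; omega)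
  simpa using this

/-- The drift of the capped weight under rates dominated by `Λ` and `Ξ`. -/
theorem IsBoundedRates.bdcDrift_min_geomWeight_le {lam mu xi : ℕ → ℝ} {L ε Λ Ξ : ℝ}
    (h : IsBoundedRates lam mu xi L) (hε : 0 ≤ ε) (N : ℕ) {i : ℕ}
    (hΛ : lam i ≤ Λ) (hΞ : 1 ≤ i → Ξ ≤ xi i) :
    bdcDrift lam mu xi (fun k => min (geomWeight ε k) (geomWeight ε N)) i
      ≤ (ε * Λ - Ξ) * min (geomWeight ε i) (geomWeight ε N) + (1 + ε) * Λ := by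
  have hmono := geomWeight_mono hε
  have hf0 : 0 ≤ min (geomWeight ε i) (geomWeight ε N) :=
    le_min (geomWeight_nonneg hε _) (geomWeight_nonneg hε _)
  -- Where the cap is active the increment is at most 0; below it the affine recursion applies.
  have hup : min (geomWeight ε (i + 1)) (geomWeight ε N) - min (geomWeight ε i) (geomWeight ε N)
      ≤ ε * min (geomWeight ε i) (geomWeight ε N) + (1 + ε) := by
    rcases le_total (geomWeight ε N) (geomWeight ε i) with hN | hN
    · have := min_le_right (geomWeight ε (i + 1)) (geomWeight ε N)
      rw [min_eq_right hN] at hf0 ⊢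
      nlinarith
    · have h1 := (min_le_left (geomWeight ε (i + 1)) (geomWeight ε N)).trans_eq
        (geomWeight_succ' ε i)
      rw [min_eq_left hN] at hf0 ⊢
      linarith
  have hup0 : 0 ≤ ε * min (geomWeight ε i) (geomWeight ε N) + (1 + ε) := by positivity
  have hlam := h.lam_nonneg i
  have hA : lam i * (min (geomWeight ε (i + 1)) (geomWeight ε N)
        - min (geomWeight ε i) (geomWeight ε N))
      ≤ Λ * (ε * min (geomWeight ε i) (geomWeight ε N) + (1 + ε)) :=
    (mul_le_mul_of_nonneg_left hup hlam).trans (mul_le_mul_of_nonneg_right hΛ hup0)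
  unfold bdcDrift
  simp only
  -- State 0 has no catastrophe, but its weight is 0, so the missing -Ξ term costs nothing.
  rcases Nat.eq_zero_or_pos i with rfl | hi
  · have h0 : min (geomWeight ε 0) (geomWeight ε N) = 0 := by
      rw [geomWeight_zero]; exact min_eq_left (geomWeight_nonneg hε N)
    rw [h0] at hA
    rw [if_pos rfl, h0]
    linarith
  · rw [if_neg hi.ne']
    have h0 : min (geomWeight ε 0) (geomWeight ε N) = 0 := by
      rw [geomWeight_zero]; exact min_eq_left (geomWeight_nonneg hε N)
    have hdown : min (geomWeight ε (i - 1)) (geomWeight ε N) ≤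
        min (geomWeight ε i) (geomWeight ε N) :=
      min_le_min_right _ (hmono (Nat.sub_le i 1))
    rw [h0]
    have hB := mul_nonneg (h.mu_nonneg i hi) (sub_nonneg.2 hdown)
    have hC := mul_le_mul_of_nonneg_right (hΞ hi) hf0
    linarith

theorem integral_exp_neg_mul_sub_le {a T : ℝ} (ha : 0 < a) :
    ∫ s in (0 : ℝ)..T, Real.exp (-a * (T - s)) ≤ 1 / a := by
  have hd : ∀ s ∈ uIcc 0 T, HasDerivAt (fun s => Real.exp (-a * (T - s)) / a)
      (Real.exp (-a * (T - s))) s := fun s _ => by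
    have h1 : HasDerivAt (fun s => -a * (T - s)) a s := by
      have := ((hasDerivAt_id s).const_sub T).const_mul (-a)
      simpa using this
    have := h1.exp.div_const a
    rwa [mul_div_assoc, div_self ha.ne', mul_one] at this
  rw [intervalIntegral.integral_eq_sub_of_hasDerivAt hd
    (Continuous.intervalIntegrable (by fun_prop) _ _)]
  have : 0 ≤ Real.exp (-a * (T - 0)) / a := by positivity
  simp only [sub_self, mul_zero, Real.exp_zero]
  linarith

/-- The Lyapunov bound on the exponentially weighted moments. -/
theorem IsKolmogorovSolution.sum_geomWeight_le {lam mu xi : ℝ → ℕ → ℝ} {Λ Ξ : ℝ → ℝ}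
    {p : ℝ → L1Seq} {L T ε M a : ℝ} {j : ℕ}
    (hp : IsKolmogorovSolution (fun s => bdcMatrix (lam s) (mu s) (xi s)) (unitVec j) p)
    (hT : 0 ≤ T) (hL : 0 ≤ L) (hε : 0 ≤ ε) (hM : 0 ≤ M) (ha : 0 < a)
    (hA : ∀ᵐ s ∂volume.restrict (Ioc 0 T), IsBoundedRates (lam s) (mu s) (xi s) L)
    (hΛint : IntervalIntegrable Λ volume 0 T) (hΞint : IntervalIntegrable Ξ volume 0 T)
    (hΛL : ∀ᵐ s ∂volume.restrict (Ioc 0 T), Λ s ≤ L)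
    (hdom : ∀ᵐ s ∂volume.restrict (Ioc 0 T), ∀ k, p s k = 0 ∨
      (lam s k ≤ Λ s ∧ (1 ≤ k → Ξ s ≤ xi s k)))
    (hexp : ∀ s ∈ Icc 0 T, Real.exp (∫ u in s..T, (ε * Λ u - Ξ u)) ≤ M * Real.exp (-a * (T - s)))
    (F : Finset ℕ) :
    ∑ k ∈ F, geomWeight ε k * p T k ≤ M * j * (1 + ε) ^ (j + 1) + L * M * (1 + ε) / a := by
  have hAs : ∀ s ∈ Icc 0 T,
      ∀ᵐ u ∂volume.restrict (Ioc 0 s), IsBoundedRates (lam u) (mu u) (xi u) L := fun s hs =>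
    ae_mono (Measure.restrict_mono (Ioc_subset_Ioc_right hs.2) le_rfl) hA
  have hnn : ∀ s ∈ Icc 0 T, ∀ k, 0 ≤ p s k := fun s hs => hp.nonneg hs.1 hL (hAs s hs)
  have hone : ∀ s ∈ Icc 0 T, HasSum (fun k => p s k) 1 := fun s hs =>
    hp.hasSum_one hs.1 hL (hAs s hs)
  -- Capping at the largest element of F makes the test function bounded, hence admissible before
  -- the moment is known to be finite, and leaves it unchanged on F.
  set N := F.sup id with hN
  set W := geomWeight ε N with hW
  have hW0 : 0 ≤ W := geomWeight_nonneg hε N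
  set f : ℕ → ℝ := fun k => min (geomWeight ε k) W with hf
  have hf0 : ∀ k, 0 ≤ f k := fun k => le_min (geomWeight_nonneg hε k) hW0
  have hfW : ∀ k, f k ≤ W := fun k => min_le_right _ _
  have hfp : ∀ s ∈ Icc 0 T, Summable fun k => f k * p s k := fun s hs =>
    Summable.of_nonneg_of_le (fun k => mul_nonneg (hf0 k) (hnn s hs k))
      (fun k => mul_le_mul_of_nonneg_right (hfW k) (hnn s hs k)) ((hone s hs).summable.mul_left W)
  set y : ℝ → ℝ := fun s => ∑' k, f k * p s k with hy
  set D : ℝ → ℝ := fun s => ∑' i, (∑' k, f k * bdcMatrix (lam s) (mu s) (xi s) k i) * p s i with hD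
  have hw : ∀ᵐ s ∂volume.restrict (Ioc 0 T), ∀ i, ∀ F : Finset ℕ,
      ∑ k ∈ F, |f k| * |bdcMatrix (lam s) (mu s) (xi s) k i| ≤ W * (2 * L) := by
    filter_upwards [hA] with s hs i F
    calc _ ≤ ∑ k ∈ F, W * |bdcMatrix (lam s) (mu s) (xi s) k i| :=
          Finset.sum_le_sum fun k _ => mul_le_mul_of_nonneg_right
            (by rw [abs_of_nonneg (hf0 k)]; exact hfW k) (abs_nonneg _)
      _ ≤ _ := by
          rw [← Finset.mul_sum]
          refine mul_le_mul_of_nonneg_left ?_ hW0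
          linarith [hs.sum_abs_le i F, hs.exitRate_le i]
  have htest : ∀ t ∈ Icc 0 T, IntervalIntegrable D volume 0 t ∧
      HasSum (fun k => f k * p t k - f k * unitVec j k) (∫ s in (0 : ℝ)..t, D s) := fun t ht =>
    hp.hasSum_test ht.1 (C := W * (2 * L))
      (ae_mono (Measure.restrict_mono (Ioc_subset_Ioc_right ht.2) le_rfl) hw) fun s hs => by
        have hs' : s ∈ Icc 0 T := ⟨hs.1, hs.2.trans ht.2⟩
        refine ⟨(summable_abs _).mul_left _, ?_⟩
        rw [tsum_mul_left, tsum_congr fun i => abs_of_nonneg (hnn s hs' i), (hone s hs').tsum_eq,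
          mul_one]
  have hy0 : y 0 = f j := by
    simp only [hy, hp.initial, unitVec_apply]
    simp
  have hyD : ∀ t ∈ Icc 0 T, y t = y 0 + ∫ s in (0 : ℝ)..t, D s := fun t ht => by
    have h0 : Summable fun k => f k * p 0 k := hfp 0 (left_mem_Icc.2 hT)
    rw [← (htest t ht).2.tsum_eq, ← hp.initial, (hfp t ht).tsum_sub h0]
    ring
  have hTm := right_mem_Icc.2 hT
  have hc : IntervalIntegrable (fun u => ε * Λ u - Ξ u) volume 0 T := (hΛint.const_mul ε).sub hΞint
  have hb : IntervalIntegrable (fun u => (1 + ε) * Λ u) volume 0 T := hΛint.const_mul _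
  have hgron := le_of_integral_eq_of_ae_le hT (htest T hTm).1 hc hb hyD (by
    filter_upwards [hA, hdom, hw, ae_restrict_mem measurableSet_Ioc] with s h1 h2 h3 hs
    have hs' := Ioc_subset_Icc_self hs
    have e : ∀ i, (∑' k, f k * bdcMatrix (lam s) (mu s) (xi s) k i)
        = bdcDrift (lam s) (mu s) (xi s) f i := fun i => (hasSum_mul_bdcMatrix _ _ _ _ i).tsum_eq
    simp only [hD, e]
    have hR : HasSum (fun i => ((ε * Λ s - Ξ s) * f i + (1 + ε) * Λ s) * p s i)
        ((ε * Λ s - Ξ s) * y s + (1 + ε) * Λ s) := by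
      have := ((hfp s hs').hasSum.mul_left (ε * Λ s - Ξ s)).add
        ((hone s hs').mul_left ((1 + ε) * Λ s))
      rw [mul_one] at this
      exact this.congr_fun fun i => by ring
    rw [← hR.tsum_eq]
    refine Summable.tsum_le_tsum (fun i => ?_) ?_ hR.summable
    -- States without mass need no comparison of rates; this admits the truncated chain, which has
    -- no catastrophes above its level.
    · rcases h2 i with h0 | ⟨hl, hx⟩
      · rw [h0, mul_zero, mul_zero]
      · exact mul_le_mul_of_nonneg_right (h1.bdcDrift_min_geomWeight_le hε N hl hx) (hnn s hs' i)
    · refine Summable.of_norm_bounded ((hone s hs').summable.mul_left (W * (2 * L))) fun i => ?_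
      rw [Real.norm_eq_abs, abs_mul, abs_of_nonneg (hnn s hs' i), ← e]
      refine mul_le_mul_of_nonneg_right ?_ (hnn s hs' i)
      have hsum : Summable fun k => ‖f k * bdcMatrix (lam s) (mu s) (xi s) k i‖ := by
        simp only [norm_mul, Real.norm_eq_abs]
        exact summable_of_sum_le (fun k => by positivity) (h3 i)
      rw [← Real.norm_eq_abs]
      refine (norm_tsum_le_tsum_norm hsum).trans (hsum.tsum_le_of_sum_le fun G => ?_)
      simpa only [norm_mul, Real.norm_eq_abs] using h3 i G)
  have hMexp : IntervalIntegrable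
      (fun s => M * Real.exp (-a * (T - s)) * ((1 + ε) * L)) volume 0 T :=
    Continuous.intervalIntegrable (by fun_prop) _ _
  -- Since the mass is 1, some state k is occupied, and there 0 ≤ lam k ≤ Λ.
  have hΛ0 : ∀ᵐ s ∂volume.restrict (Ioc 0 T), 0 ≤ Λ s := by
    filter_upwards [hA, hdom, ae_restrict_mem measurableSet_Ioc] with s h1 h2 hs
    obtain ⟨k, hk⟩ : ∃ k, p s k ≠ 0 := by
      by_contra! h0
      have := (hone s (Ioc_subset_Icc_self hs)).tsum_eq
      simp [h0] at this
    exact (h1.lam_nonneg k).trans ((h2 k).resolve_left hk).1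
  have hint : ∫ s in (0 : ℝ)..T, Real.exp (∫ u in s..T, (ε * Λ u - Ξ u)) * ((1 + ε) * Λ s)
      ≤ L * M * (1 + ε) / a := by
    calc _ ≤ ∫ s in (0 : ℝ)..T, M * Real.exp (-a * (T - s)) * ((1 + ε) * L) := by
          refine intervalIntegral.integral_mono_ae_restrict hT (hb.continuousOn_mul ?_) hMexp ?_
          · have := (hc.absolutelyContinuousOnInterval_intervalIntegral
              (c := T) right_mem_uIcc).neg.rexp.continuousOn
            refine this.congr fun s _ => ?_
            simp only [Pi.neg_apply]
            rw [← intervalIntegral.integral_symm]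
          · rw [← restrict_Ioc_eq_restrict_Icc]
            filter_upwards [hΛ0, hΛL, ae_restrict_mem measurableSet_Ioc] with s h1 h2 hs
            exact mul_le_mul (hexp s (Ioc_subset_Icc_self hs)) (by gcongr) (by positivity)
              (by positivity)
      _ = L * M * (1 + ε) * ∫ s in (0 : ℝ)..T, Real.exp (-a * (T - s)) := by
          rw [← intervalIntegral.integral_const_mul]
          exact intervalIntegral.integral_congr fun s _ => by ring
      _ ≤ L * M * (1 + ε) * (1 / a) :=
          mul_le_mul_of_nonneg_left (integral_exp_neg_mul_sub_le ha) (by positivity)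
      _ = _ := by ring
  have hinit : Real.exp (∫ u in (0 : ℝ)..T, (ε * Λ u - Ξ u)) * y 0
      ≤ M * j * (1 + ε) ^ (j + 1) := by
    have h1 : Real.exp (∫ u in (0 : ℝ)..T, (ε * Λ u - Ξ u)) ≤ M := by
      refine (hexp 0 (left_mem_Icc.2 hT)).trans ?_
      have : Real.exp (-a * (T - 0)) ≤ 1 := Real.exp_le_one_iff.2 (by nlinarith)
      nlinarith
    have h2 : y 0 ≤ j * (1 + ε) ^ (j + 1) :=
      hy0.le.trans ((min_le_left _ _).trans (geomWeight_le hε j))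
    rw [mul_assoc]
    exact mul_le_mul h1 h2 (hy0 ▸ hf0 j) hM
  have hle : ∑ k ∈ F, geomWeight ε k * p T k ≤ y T := by
    refine le_trans (le_of_eq (Finset.sum_congr rfl fun k hk => ?_))
      ((hfp T hTm).sum_le_tsum F fun k _ => mul_nonneg (hf0 k) (hnn T hTm k))
    have : k ≤ N := Finset.le_sup (f := id) hk
    rw [hf]; simp only
    rw [min_eq_left (geomWeight_mono hε this)]
  linarith

/-! ### The truncated chain and the truncation error of the generator -/

/-- The only jump leaving {0, ..., n} is the birth from n, and zero extension amounts to zero rates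
above n. So every result on these chains applies to the truncation. -/
theorem truncMatrix_bdcMatrix (n : ℕ) (lam mu xi : ℕ → ℝ) :
    truncMatrix n (bdcMatrix lam mu xi) = bdcMatrix (fun k => if k < n then lam k else 0)
      (fun k => if k ≤ n then mu k else 0) (fun k => if k ≤ n then xi k else 0) := by
  ext i j
  unfold truncMatrix
  by_cases hout : n < i ∨ n < j
  · rw [if_pos hout]
    unfold bdcMatrix
    by_cases hj : j ≤ n
    · have hi : n < i := by omega
      have h1 : i ≠ j := by omega
      have h2 : i + 1 ≠ j := by omega
      have h3 : i ≠ 0 := by omega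
      have h4 : ¬ (i = j + 1 ∧ j < n) := by omega
      simp only [h1, h2, h3, if_false, add_zero]
      split_ifs <;> simp_all
    · have h1 : ¬ j < n := by omega
      simp [hj, h1]
  · rw [if_neg hout]
    have hi : i ≤ n := by omega
    have hj : j ≤ n := by omega
    by_cases hij : i = j
    · subst hij
      rw [if_pos rfl]
      -- A column sum over {0, ..., n} is the drift of the indicator of that set, from which the
      -- truncated diagonal entry is read off.
      set f : ℕ → ℝ := fun k => if k ∈ Finset.range (n + 1) then 1 else 0 with hf
      have hs : ∑ k ∈ Finset.range (n + 1), bdcMatrix lam mu xi k i = bdcDrift lam mu xi f i := by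
        rw [← (hasSum_mul_bdcMatrix lam mu xi f i).tsum_eq,
          tsum_eq_sum (s := Finset.range (n + 1)) fun k hk => by
            simp only [hf, if_neg hk, zero_mul]]
        exact Finset.sum_congr rfl fun k hk => by simp only [hf, if_pos hk, one_mul]
      have he := Finset.sum_erase_add (Finset.range (n + 1)) (fun k => bdcMatrix lam mu xi k i)
        (Finset.mem_range.2 (by omega : i < n + 1))
      rw [hs] at he
      rw [bdcMatrix_self] at he ⊢
      have hm : ∀ k, k ≤ n → f k = 1 := fun k hk => if_pos (Finset.mem_range.2 (by omega))
      have hdrift : bdcDrift lam mu xi f i = lam i * (f (i + 1) - 1) := by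
        unfold bdcDrift
        rw [hm i hi, hm (i - 1) (by omega), hm 0 (by omega)]
        simp
      have hlast : lam i * f (i + 1) = if i < n then lam i else 0 := by
        by_cases hin : i < n
        · rw [hm _ hin, if_pos hin, mul_one]
        · have : f (i + 1) = 0 := if_neg (by simpa using hin)
          rw [this, if_neg hin, mul_zero]
      rw [hdrift] at he
      unfold exitRate at he ⊢
      simp only [if_pos hi]
      linarith
    · rw [if_neg hij]
      unfold bdcMatrix
      beta_reduce
      rw [if_neg hij, if_neg hij, if_pos hj, if_pos hj]
      congr 2
      by_cases h1 : i = j + 1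
      · rw [if_pos h1, if_pos h1, if_pos (by omega)]
      · rw [if_neg h1, if_neg h1]

theorem bdcMatrix_sub (lam mu xi lam' mu' xi' : ℕ → ℝ) (k i : ℕ) :
    bdcMatrix lam mu xi k i - bdcMatrix lam' mu' xi' k i
      = bdcMatrix (lam - lam') (mu - mu') (xi - xi') k i := by
  simp only [bdcMatrix_eq, Pi.sub_apply]
  split_ifs <;> ring

namespace IsBoundedRates

variable {lam mu xi : ℕ → ℝ} {L : ℝ}

theorem trunc (h : IsBoundedRates lam mu xi L) (n : ℕ) :
    IsBoundedRates (fun k => if k < n then lam k else 0)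
      (fun k => if k ≤ n then mu k else 0) (fun k => if k ≤ n then xi k else 0) L where
  lam_nonneg i := by have := h.lam_nonneg i; split_ifs <;> simp [this]
  mu_nonneg i hi := by have := h.mu_nonneg i hi; split_ifs <;> simp [this]
  xi_nonneg i hi := by have := h.xi_nonneg i hi; split_ifs <;> simp [this]
  exitRate_le i := by
    refine le_trans ?_ (h.exitRate_le i)
    have h1 := h.lam_nonneg i
    unfold exitRate
    rcases Nat.eq_zero_or_pos i with rfl | hi
    · simp only [↓reduceIte]
      split_ifs <;> simp [h1]
    · have h2 := h.mu_nonneg i hi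
      have h3 := h.xi_nonneg i hi
      beta_reduce
      split_ifs <;> linarith

/-- The difference is again such a generator, with the suppressed rates; these vanish at all states
below n. -/
theorem sum_abs_sub_trunc_le (h : IsBoundedRates lam mu xi L) (n i : ℕ) (F : Finset ℕ) :
    ∑ k ∈ F, |bdcMatrix lam mu xi k i - truncMatrix n (bdcMatrix lam mu xi) k i|
      ≤ if n ≤ i then 2 * L else 0 := by
  rw [truncMatrix_bdcMatrix]
  simp only [bdcMatrix_sub]
  have hd : IsBoundedRates (lam - fun k => if k < n then lam k else 0)
      (mu - fun k => if k ≤ n then mu k else 0) (xi - fun k => if k ≤ n then xi k else 0) L :=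
    { lam_nonneg := fun i => by
        have := h.lam_nonneg i; simp only [Pi.sub_apply]; split_ifs <;> simp [this]
      mu_nonneg := fun i hi => by
        have := h.mu_nonneg i hi; simp only [Pi.sub_apply]; split_ifs <;> simp [this]
      xi_nonneg := fun i hi => by
        have := h.xi_nonneg i hi; simp only [Pi.sub_apply]; split_ifs <;> simp [this]
      exitRate_le := fun i => by
        refine le_trans ?_ (h.exitRate_le i)
        have h1 := h.lam_nonneg i
        unfold exitRate
        simp only [Pi.sub_apply]
        rcases Nat.eq_zero_or_pos i with rfl | hi
        · simp only [↓reduceIte]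
          split_ifs <;> simp [h1]
        · have h2 := h.mu_nonneg i hi
          have h3 := h.xi_nonneg i hi
          split_ifs <;> linarith }
  refine (hd.sum_abs_le i F).trans ?_
  split_ifs with hi
  · linarith [hd.exitRate_le i]
  · have h1 : i < n := by omega
    simp [exitRate, h1, h1.le]

/-- Below n no jump changes the tail function. At n a birth adds n+1, and n W ≤ g(n). Above n the
drift is at most L i, and i W ≤ g(i). The factor (n+1)/n covers both cases. -/
theorem abs_bdcDrift_tail_le (h : IsBoundedRates lam mu xi L) {n : ℕ} (hn : 1 ≤ n) {W : ℝ}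
    (hW : 0 < W) {g : ℕ → ℝ} (hg0 : ∀ k, 0 ≤ g k) (hg : ∀ k : ℕ, n ≤ k → k * W ≤ g k) (i : ℕ) :
    |bdcDrift lam mu xi (fun k => if n < k then (k : ℝ) else 0) i|
      ≤ L * (n + 1) / (n * W) * g i := by
  have hL := h.bound_nonneg
  have hn' : (0 : ℝ) < n := by exact_mod_cast hn
  unfold bdcDrift
  rcases lt_trichotomy i n with hi | rfl | hi
  · have h1 : ¬ n < i + 1 := by omega
    have h2 : ¬ n < i := by omega
    have h3 : ¬ n < i - 1 := by omega
    simp only [h1, h2, h3, Nat.not_lt_zero, if_false, sub_self, mul_zero, add_zero, ite_self,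
      abs_zero]
    have := hg0 i
    positivity
  · have h1 : i < i + 1 := by omega
    have h2 : ¬ i < i := by omega
    have h3 : ¬ i < i - 1 := by omega
    simp only [h1, h2, h3, Nat.not_lt_zero, if_false, if_true, sub_self, sub_zero, mul_zero,
      add_zero, ite_self]
    have h4 := h.lam_nonneg i
    rw [abs_of_nonneg (by positivity)]
    have h5 := hg i le_rfl
    calc lam i * ((i + 1 : ℕ) : ℝ) ≤ L * (i + 1) := by
          push_cast; exact mul_le_mul_of_nonneg_right (h.lam_le i) (by positivity)
      _ = L * (i + 1) / (i * W) * (i * W) := by field_simp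
      _ ≤ _ := by gcongr
  · have h1 : n < i + 1 := by omega
    have h0 : i ≠ 0 := by omega
    simp only [h1, hi, h0, Nat.not_lt_zero, if_false, if_true, zero_sub]
    have hi1 : (1 : ℝ) ≤ i := by exact_mod_cast (by omega : 1 ≤ i)
    have h4 := h.lam_nonneg i
    have h5 := h.mu_nonneg i (by omega)
    have h6 := h.xi_nonneg i (by omega)
    have h7 := h.exitRate_le i
    unfold exitRate at h7
    rw [if_neg h0] at h7
    set b : ℝ := if n < i - 1 then ((i - 1 : ℕ) : ℝ) else 0 with hb
    have hb0 : 0 ≤ b := by rw [hb]; split_ifs <;> positivity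
    have hbi : b ≤ i := by
      rw [hb]; split_ifs
      · exact_mod_cast Nat.sub_le i 1
      · positivity
    have h8 : |lam i * (((i + 1 : ℕ) : ℝ) - i) + (mu i * (b - i) + xi i * -(i : ℝ))| ≤ L * i := by
      push_cast
      rw [abs_le]
      constructor
      · nlinarith [mul_nonneg h5 hb0, mul_nonneg h4 (by linarith : (0 : ℝ) ≤ i)]
      · nlinarith [mul_nonneg h5 (sub_nonneg.2 hbi), mul_nonneg h6 (by linarith : (0 : ℝ) ≤ i),
          h.lam_le i]
    refine h8.trans ?_
    calc L * i ≤ L * i * ((n + 1) / n) := by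
          refine le_mul_of_one_le_right (by positivity) ?_
          rw [one_le_div hn']; linarith
      _ = L * (n + 1) / (n * W) * (i * W) := by field_simp
      _ ≤ _ := by
          have := hg i hi.le
          gcongr

end IsBoundedRates

/-! ### Tail mean and the weight W_n -/

theorem summable_and_tsum_le_of_sum_le {u : ℕ → ℝ} {K : ℝ} (h0 : ∀ k, 0 ≤ u k)
    (hK : ∀ F : Finset ℕ, ∑ k ∈ F, u k ≤ K) : Summable u ∧ ∑' k, u k ≤ K :=
  ⟨summable_of_sum_le h0 hK, (summable_of_sum_le h0 hK).tsum_le_of_sum_le hK⟩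

/-- The part of the mean above level `n` moves at a bounded speed. -/
theorem IsKolmogorovSolution.abs_tail_mean_sub_le {lam mu xi : ℝ → ℕ → ℝ} {p : ℝ → L1Seq}
    {L T W K : ℝ} {j n : ℕ} {g : ℕ → ℝ}
    (hp : IsKolmogorovSolution (fun s => bdcMatrix (lam s) (mu s) (xi s)) (unitVec j) p)
    (hT : 0 ≤ T) (hL : 0 ≤ L) (hn : 1 ≤ n) (hW : 0 < W)
    (hA : ∀ᵐ s ∂volume.restrict (Ioc 0 T), IsBoundedRates (lam s) (mu s) (xi s) L)
    (hgk : ∀ k : ℕ, (k : ℝ) ≤ g k) (hg : ∀ k : ℕ, n ≤ k → k * W ≤ g k)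
    (hK : ∀ s ∈ Icc 0 T, ∀ F : Finset ℕ, ∑ k ∈ F, g k * p s k ≤ K) :
    ∃ I, HasSum (fun k => (if n < k then (k : ℝ) else 0) * p T k
        - (if n < k then (k : ℝ) else 0) * unitVec j k) I ∧
      |I| ≤ L * (n + 1) / (n * W) * K * T := by
  have hg0 : ∀ k, 0 ≤ g k := fun k => (Nat.cast_nonneg k).trans (hgk k)
  have hAs : ∀ s ∈ Icc 0 T,
      ∀ᵐ u ∂volume.restrict (Ioc 0 s), IsBoundedRates (lam u) (mu u) (xi u) L := fun s hs =>
    ae_mono (Measure.restrict_mono (Ioc_subset_Ioc_right hs.2) le_rfl) hA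
  have hnn : ∀ s ∈ Icc 0 T, ∀ k, 0 ≤ p s k := fun s hs => hp.nonneg hs.1 hL (hAs s hs)
  have hone : ∀ s ∈ Icc 0 T, HasSum (fun k => p s k) 1 := fun s hs =>
    hp.hasSum_one hs.1 hL (hAs s hs)
  have hgp : ∀ s ∈ Icc 0 T, (Summable fun k => g k * p s k) ∧ ∑' k, g k * p s k ≤ K := fun s hs =>
    summable_and_tsum_le_of_sum_le (fun k => mul_nonneg (hg0 k) (hnn s hs k)) (hK s hs)
  set f : ℕ → ℝ := fun k => if n < k then (k : ℝ) else 0 with hf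
  have hf0 : ∀ k, 0 ≤ f k := fun k => by simp only [hf]; split_ifs <;> positivity
  have hfk : ∀ k, f k ≤ k := fun k => by simp only [hf]; split_ifs <;> simp
  set κ : ℝ := L * (n + 1) / (n * W) with hκ
  have hκ0 : 0 ≤ κ := by positivity
  have htest := hp.hasSum_test hT (f := f) (w := fun i => (κ + 2 * L) * g i)
    (C := (κ + 2 * L) * K) (by
      filter_upwards [hA] with s hs i F
      refine (hs.sum_mul_abs_le hf0 i F).trans ?_
      have h1 := (le_abs_self _).trans (hs.abs_bdcDrift_tail_le hn hW hg0 hg i)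
      have h2 : exitRate (lam s) (mu s) (xi s) i * f i ≤ L * g i :=
        mul_le_mul (hs.exitRate_le i) ((hfk i).trans (hgk i)) (hf0 i) hL
      linarith) (fun s hs => by
      have e : (fun i => (κ + 2 * L) * g i * |p s i|) = fun i => (κ + 2 * L) * (g i * p s i) := by
        ext i; rw [abs_of_nonneg (hnn s hs i), mul_assoc]
      rw [e]
      refine ⟨(hgp s hs).1.mul_left _, ?_⟩
      rw [tsum_mul_left]
      exact mul_le_mul_of_nonneg_left (hgp s hs).2 (by positivity))
  refine ⟨_, htest.2, ?_⟩
  have hbound : ∀ᵐ s, s ∈ uIoc 0 T →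
      ‖∑' i, (∑' k, f k * bdcMatrix (lam s) (mu s) (xi s) k i) * p s i‖ ≤ κ * K := by
    rw [uIoc_of_le hT, ← ae_restrict_iff' measurableSet_Ioc]
    filter_upwards [hA, ae_restrict_mem measurableSet_Ioc] with s h1 hs
    have hs' := Ioc_subset_Icc_self hs
    have e : ∀ i, (∑' k, f k * bdcMatrix (lam s) (mu s) (xi s) k i)
        = bdcDrift (lam s) (mu s) (xi s) f i := fun i => (hasSum_mul_bdcMatrix _ _ _ _ i).tsum_eq
    simp only [e]
    have hb : ∀ i, ‖bdcDrift (lam s) (mu s) (xi s) f i * p s i‖ ≤ κ * (g i * p s i) := fun i => by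
      rw [norm_mul, Real.norm_eq_abs, Real.norm_eq_abs, abs_of_nonneg (hnn s hs' i), ← mul_assoc]
      exact mul_le_mul_of_nonneg_right (h1.abs_bdcDrift_tail_le hn hW hg0 hg i) (hnn s hs' i)
    refine (tsum_of_norm_bounded ((hgp s hs').1.hasSum.mul_left κ) hb).trans ?_
    exact mul_le_mul_of_nonneg_left (hgp s hs').2 hκ0
  have := intervalIntegral.norm_integral_le_of_norm_le_const_ae hbound
  rwa [sub_zero, abs_of_nonneg hT, Real.norm_eq_abs] at this

/-- Every term of the infimum is at least (k+1-n)/k ≥ 1/n, because n(k+1-n) - k = (n-1)(k-n) ≥ 0.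
The upper bound just adds the missing terms d_1, ..., d_{n-1}. -/
theorem truncWeight_pos_and_mul_le {ε : ℝ} (hε : 0 ≤ ε) {n : ℕ} (hn : 1 ≤ n) :
    0 < truncWeight (fun i => (1 + ε) ^ i) n ∧
    ∀ k : ℕ, n ≤ k → k * truncWeight (fun i => (1 + ε) ^ i) n ≤ geomWeight ε k := by
  have hn' : (0 : ℝ) < n := by exact_mod_cast hn
  have : Nonempty {k : ℕ // n ≤ k} := ⟨⟨n, le_rfl⟩⟩
  constructor
  · refine lt_of_lt_of_le (one_div_pos.2 hn') (le_ciInf fun ⟨k, hk⟩ => ?_)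
    have hk' : (0 : ℝ) < k := by exact_mod_cast (by omega : 0 < k)
    rw [div_le_div_iff₀ hn' hk', one_mul]
    have h1 : ((k + 1 - n : ℕ) : ℝ) ≤ ∑ i ∈ Finset.Icc n k, (1 + ε) ^ i := by
      have : ∑ _i ∈ Finset.Icc n k, (1 : ℝ) ≤ ∑ i ∈ Finset.Icc n k, (1 + ε) ^ i :=
        Finset.sum_le_sum fun i _ => one_le_pow₀ (by linarith)
      simpa using this
    rw [Nat.cast_sub (by omega)] at h1
    push_cast at h1
    have h2 : (n : ℝ) ≤ k := by exact_mod_cast hk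
    have h3 : (1 : ℝ) ≤ n := by exact_mod_cast hn
    nlinarith [mul_le_mul_of_nonneg_right h1 hn'.le,
      mul_nonneg (sub_nonneg.2 h3) (sub_nonneg.2 h2)]
  · intro k hk
    have hk' : (0 : ℝ) < k := by exact_mod_cast (by omega : 0 < k)
    have hbdd : BddBelow (range fun k : {k : ℕ // n ≤ k} =>
        (∑ i ∈ Finset.Icc n (k : ℕ), (1 + ε) ^ i) / ((k : ℕ) : ℝ)) := by
      refine ⟨0, ?_⟩
      rintro _ ⟨k, rfl⟩
      exact div_nonneg (Finset.sum_nonneg fun i _ => by positivity) (Nat.cast_nonneg _)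
    have h1 := ciInf_le hbdd ⟨k, hk⟩
    have h2 : truncWeight (fun i => (1 + ε) ^ i) n
        ≤ (∑ i ∈ Finset.Icc n k, (1 + ε) ^ i) / (k : ℝ) := h1
    rw [le_div_iff₀ hk', mul_comm] at h2
    refine h2.trans (Finset.sum_le_sum_of_subset_of_nonneg (Finset.Icc_subset_Icc_left hn)
      fun i _ _ => by positivity)

/-- States above the truncation level are frozen in the truncated process. -/
theorem IsKolmogorovSolution.eq_of_lt_truncMatrix {A : ℝ → Matrix ℕ ℕ ℝ} {p0 : L1Seq}
    {p : ℝ → L1Seq} {n : ℕ} (hp : IsKolmogorovSolution (fun t => truncMatrix n (A t)) p0 p)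
    {t : ℝ} (ht : 0 ≤ t) {k : ℕ} (hk : n < k) : p t k = p0 k := by
  rw [hp.integral_eq k t ht]
  simp [truncMatrix, hk]

theorem isBoundedRates_queue {S : ℕ} {lam mu xi : ℝ → ℝ} {z : ℕ → ℝ} {L t : ℝ}
    (hlam : 0 ≤ lam t) (hmu : 0 ≤ mu t) (hxi : 0 ≤ xi t) (hz : ∀ k, 1 ≤ k → 0 ≤ z k)
    (hL : ∀ i, |queueMatrix S lam mu xi z t i i| ≤ L) :
    IsBoundedRates (fun _ => lam t) (fun k => (min k S : ℕ) * mu t) (fun k => z k * xi t) L where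
  lam_nonneg _ := hlam
  mu_nonneg _ _ := by positivity
  xi_nonneg i hi := mul_nonneg (hz i hi) hxi
  exitRate_le i := by
    have := hL i
    rw [queueMatrix, bdcMatrix_self, abs_neg] at this
    exact (le_abs_self _).trans this

/-! ### Assembly of the error bounds -/

/-- Truncation error of the distribution and of the mean for a birth-death-catastrophe chain,
given a bound `K` on weighted moments. -/
theorem truncation_error_le {lam mu xi : ℝ → ℕ → ℝ} {p q : ℝ → L1Seq} {L T W K : ℝ} {j n : ℕ}
    {g : ℕ → ℝ}
    (hp : IsKolmogorovSolution (fun s => bdcMatrix (lam s) (mu s) (xi s)) (unitVec j) p)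
    (hq : IsKolmogorovSolution (fun s => truncMatrix n (bdcMatrix (lam s) (mu s) (xi s)))
      (unitVec j) q)
    (hT : 0 ≤ T) (hL : 0 ≤ L) (hn : 1 ≤ n) (hW : 0 < W)
    (hA : ∀ᵐ s ∂volume.restrict (Ioc 0 T), IsBoundedRates (lam s) (mu s) (xi s) L)
    (hgk : ∀ k : ℕ, (k : ℝ) ≤ g k) (hg : ∀ k : ℕ, n ≤ k → k * W ≤ g k)
    (hpK : ∀ s ∈ Icc 0 T, ∀ F : Finset ℕ, ∑ k ∈ F, g k * p s k ≤ K)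
    (hqK : ∀ s ∈ Icc 0 T, ∀ F : Finset ℕ, ∑ k ∈ F, g k * q s k ≤ K) :
    ‖p T - q T‖ ≤ 2 * L * T / (n * W) * K ∧
    Summable (fun k : ℕ => (k : ℝ) * p T k) ∧ Summable (fun k : ℕ => (k : ℝ) * q T k) ∧
    |seqMean (p T) - seqMean (q T)| ≤ 3 * L * (n + 1) * T / (n * W) * K := by
  have hn' : (0 : ℝ) < n := by exact_mod_cast hn
  have hTm := right_mem_Icc.2 hT
  have hg0 : ∀ k, 0 ≤ g k := fun k => (Nat.cast_nonneg k).trans (hgk k)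
  have hAs : ∀ s ∈ Icc 0 T,
      ∀ᵐ u ∂volume.restrict (Ioc 0 s), IsBoundedRates (lam u) (mu u) (xi u) L := fun s hs =>
    ae_mono (Measure.restrict_mono (Ioc_subset_Ioc_right hs.2) le_rfl) hA
  have hpnn : ∀ k, 0 ≤ p T k := hp.nonneg hT hL hA
  have hq' := hq
  simp only [truncMatrix_bdcMatrix] at hq'
  have hqnn : ∀ s ∈ Icc 0 T, ∀ k, 0 ≤ q s k := fun s hs =>
    hq'.nonneg hs.1 hL ((hAs s hs).mono fun u hu => hu.trunc n)
  have hK0 : 0 ≤ K := by simpa using hpK T hTm ∅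
  have hnorm : ‖p T - q T‖ ≤ 2 * L * T / (n * W) * K := by
    have h := hp.norm_sub_le hq hT hL (β := 2 * L / (n * W) * K) (by positivity) hA
      (hA.mono fun s hs => hs.sum_abs_sub_trunc_le n) (fun s hs => by
        -- Markov's inequality in weighted form: the indicator of i ≥ n is at most g(i)/(nW).
        have hle : ∀ i, (if n ≤ i then 2 * L else 0) * |q s i|
            ≤ 2 * L / (n * W) * (g i * q s i) := fun i => by
          rw [abs_of_nonneg (hqnn s hs i), ← mul_assoc]
          refine mul_le_mul_of_nonneg_right ?_ (hqnn s hs i)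
          split_ifs with hi
          · have h1 : (n : ℝ) * W ≤ g i :=
              (mul_le_mul_of_nonneg_right (by exact_mod_cast hi) hW.le).trans (hg i hi)
            calc 2 * L = 2 * L / (n * W) * (n * W) := by field_simp
              _ ≤ _ := by gcongr
          · have := hg0 i
            positivity
        have hs1 := summable_and_tsum_le_of_sum_le
          (fun k => mul_nonneg (hg0 k) (hqnn s hs k)) (hqK s hs)
        have hs2 : Summable fun i => (if n ≤ i then 2 * L else 0) * |q s i| :=
          Summable.of_nonneg_of_le (fun i => mul_nonneg (by split_ifs <;> positivity)
            (abs_nonneg _)) hle (hs1.1.mul_left _)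
        refine ⟨hs2, (hs2.tsum_le_tsum hle (hs1.1.mul_left _)).trans ?_⟩
        rw [tsum_mul_left]
        exact mul_le_mul_of_nonneg_left hs1.2 (by positivity))
    rw [sub_self, norm_zero, zero_add] at h
    refine h.trans (le_of_eq ?_)
    ring
  have hps : Summable fun k : ℕ => (k : ℝ) * p T k :=
    Summable.of_nonneg_of_le (fun k => mul_nonneg (Nat.cast_nonneg k) (hpnn k))
      (fun k => mul_le_mul_of_nonneg_right (hgk k) (hpnn k))
      (summable_and_tsum_le_of_sum_le (fun k => mul_nonneg (hg0 k) (hpnn k)) (hpK T hTm)).1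
  have hqs : Summable fun k : ℕ => (k : ℝ) * q T k :=
    Summable.of_nonneg_of_le (fun k => mul_nonneg (Nat.cast_nonneg k) (hqnn T hTm k))
      (fun k => mul_le_mul_of_nonneg_right (hgk k) (hqnn T hTm k))
      (summable_and_tsum_le_of_sum_le (fun k => mul_nonneg (hg0 k) (hqnn T hTm k)) (hqK T hTm)).1
  refine ⟨hnorm, hps, hqs, ?_⟩
  obtain ⟨I, hI, hIle⟩ := hp.abs_tail_mean_sub_le hT hL hn hW hA hgk hg hpK
  set head : ℕ → ℝ := fun k => (if n < k then 0 else (k : ℝ)) * (p T - q T) k with hhead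
  have hheadle : ∀ k, ‖head k‖ ≤ n * |(p T - q T) k| := fun k => by
    rw [hhead, norm_mul, Real.norm_eq_abs, Real.norm_eq_abs]
    refine mul_le_mul_of_nonneg_right ?_ (abs_nonneg _)
    split_ifs with hk
    · simp
    · rw [Nat.abs_cast]; exact_mod_cast not_lt.1 hk
  have hbound : HasSum (fun k => n * |(p T - q T) k|) (n * ‖p T - q T‖) := by
    rw [norm_eq_tsum_abs]
    exact (summable_abs (p T - q T)).hasSum.mul_left (n : ℝ)
  have hheads : Summable head := Summable.of_norm_bounded hbound.summable hheadle
  have hheadn : ‖∑' k, head k‖ ≤ n * ‖p T - q T‖ := tsum_of_norm_bounded hbound hheadle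
  have hsplit : seqMean (p T) - seqMean (q T) = ∑' k, head k + I := by
    unfold seqMean
    rw [← hps.tsum_sub hqs, ← hI.tsum_eq, ← hheads.tsum_add hI.summable]
    refine tsum_congr fun k => ?_
    simp only [hhead, lp.coeFn_sub, Pi.sub_apply]
    split_ifs with hk
    -- Above n the truncated solution still equals e_j, so the tail of the difference of means is
    -- exactly I.
    · rw [hq.eq_of_lt_truncMatrix hT hk]; ring
    · ring
  rw [hsplit]
  rw [Real.norm_eq_abs] at hheadn
  have h1 : (n : ℝ) * ‖p T - q T‖ ≤ n * (2 * L * T / (n * W) * K) :=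
    mul_le_mul_of_nonneg_left hnorm hn'.le
  have h2 : 0 ≤ L * T / (n * W) * K := by positivity
  -- Head 2n plus tail n+1, with slack 2, makes 3(n+1).
  have h3 : 3 * L * (n + 1) * T / (n * W) * K
      = n * (2 * L * T / (n * W) * K) + L * (n + 1) / (n * W) * K * T
        + 2 * (L * T / (n * W) * K) := by ring
  linarith [abs_add_le (∑' k, head k) I]

theorem corollary2
    -- the number of servers, the intensity functions, and the coefficients of the catastrophe rates
    (S : ℕ) (lam mu xi : ℝ → ℝ) (z : ℕ → ℝ)
    (hlam : ∀ t, 0 ≤ t → 0 ≤ lam t) (hmu : ∀ t, 0 ≤ t → 0 ≤ mu t) (hxi : ∀ t, 0 ≤ t → 0 ≤ xi t)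
    (hlam_int : LocallyIntegrableOn lam (Ici 0) volume)
    (hmu_int : LocallyIntegrableOn mu (Ici 0) volume)
    (hxi_int : LocallyIntegrableOn xi (Ici 0) volume)
    -- essential boundedness of the intensity matrix
    (L : ℝ) (hL : ∀ᵐ t ∂(volume.restrict (Ici (0 : ℝ))),
      ∀ i : ℕ, |queueMatrix S lam mu xi z t i i| ≤ L)
    -- large catastrophe rates
    (ζ : ℝ) (hζ : IsGLB (z '' Ici 1) ζ) (hζ_pos : 0 < ζ)
    (ε : ℝ) (hε : 0 < ε)
    (hdiv : Tendsto (fun T : ℝ => ∫ u in (0 : ℝ)..T, (ζ * xi u - ε * lam u)) atTop atTop)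
    (M a : ℝ) (hM : 0 < M) (ha : 0 < a)
    (hexp : ∀ s t : ℝ, 0 ≤ s → s ≤ t →
      Real.exp (-∫ u in s..t, (ζ * xi u - ε * lam u)) ≤ M * Real.exp (-a * (t - s)))
    -- the truncation level, the initial state, and the two state distributions
    (n : ℕ) (hn : 1 ≤ n) (j : ℕ) (p pn : ℝ → L1Seq)
    (hp : IsKolmogorovSolution (queueMatrix S lam mu xi z) (unitVec j) p)
    (hpn : IsKolmogorovSolution (fun t => truncMatrix n (queueMatrix S lam mu xi z t))
      (unitVec j) pn)
    (t : ℝ) (ht : 0 ≤ t) :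
    ‖p t - pn t‖ ≤ 8 * L * t / (n * truncWeight (fun i => (1 + ε) ^ i) n)
        * (M * j * (1 + ε) ^ (j + 1) + L * M * (1 + ε) / a) ∧
    Summable (fun k : ℕ => (k : ℝ) * p t k) ∧
    Summable (fun k : ℕ => (k : ℝ) * pn t k) ∧
    |seqMean (p t) - seqMean (pn t)|
      ≤ 3 * L * (n + 1) * t / (n * truncWeight (fun i => (1 + ε) ^ i) n)
        * (M * j * (1 + ε) ^ (j + 1) + L * M * (1 + ε) / a) := by
  have hz : ∀ k, 1 ≤ k → ζ ≤ z k := fun k hk => hζ.1 ⟨k, hk, rfl⟩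
  have hA : ∀ s, ∀ᵐ u ∂volume.restrict (Ioc 0 s), IsBoundedRates (fun _ => lam u)
      (fun k => (min k S : ℕ) * mu u) (fun k => z k * xi u) L := fun s => by
    filter_upwards [ae_mono (Measure.restrict_mono
      (fun x hx => hx.1.le : Ioc 0 s ⊆ Ici 0) le_rfl) hL, ae_restrict_mem measurableSet_Ioc]
      with u h1 hu
    exact isBoundedRates_queue (hlam u hu.1.le) (hmu u hu.1.le) (hxi u hu.1.le)
      (fun k hk => hζ_pos.le.trans (hz k hk)) h1
  have hL0 : 0 ≤ L := by
    -- The half-line has positive measure, so the almost-everywhere bound holds at some time and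
    -- forces L ≥ 0.
    have : (ae (volume.restrict (Ici (0 : ℝ)))).NeBot := by
      rw [ae_neBot, Ne, Measure.restrict_eq_zero, Real.volume_Ici]
      exact ENNReal.top_ne_zero
    obtain ⟨u, hu⟩ := hL.exists
    exact (abs_nonneg _).trans (hu 0)
  have hInt : ∀ {f : ℝ → ℝ}, LocallyIntegrableOn f (Ici 0) volume → ∀ s, 0 ≤ s →
      IntervalIntegrable f volume 0 s := fun hf s hs =>
    (intervalIntegrable_iff_integrableOn_Icc_of_le hs).2
      (hf.integrableOn_compact_subset Icc_subset_Ici_self isCompact_Icc)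
  have hexp' : ∀ s, ∀ u ∈ Icc 0 s,
      Real.exp (∫ v in u..s, (ε * lam v - ζ * xi v)) ≤ M * Real.exp (-a * (s - u)) :=
    fun s u hu => by
    refine le_trans (le_of_eq ?_) (hexp u s hu.1 hu.2)
    rw [← intervalIntegral.integral_neg]
    simp only [neg_sub]
  have hM1 : 1 ≤ M := by simpa using hexp 0 0 le_rfl le_rfl
  set K := M * j * (1 + ε) ^ (j + 1) + L * M * (1 + ε) / a with hK
  have hp' : IsKolmogorovSolution (fun s => bdcMatrix (fun _ => lam s)
      (fun k => (min k S : ℕ) * mu s) (fun k => z k * xi s)) (unitVec j) p := hp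
  have hpn' : IsKolmogorovSolution (fun s => truncMatrix n (bdcMatrix (fun _ => lam s)
      (fun k => (min k S : ℕ) * mu s) (fun k => z k * xi s))) (unitVec j) pn := hpn
  have hpn'' := hpn'
  simp only [truncMatrix_bdcMatrix] at hpn''
  have hAn := fun s => (hA s).mono fun u hu => hu.trunc n
  have hlamL : ∀ s, ∀ᵐ u ∂volume.restrict (Ioc 0 s), lam u ≤ L := fun s =>
    (hA s).mono fun u hu => hu.lam_le 0
  have hpK : ∀ s ∈ Icc 0 t, ∀ F : Finset ℕ, ∑ k ∈ F, geomWeight ε k * p s k ≤ K := fun s hs F =>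
    hp'.sum_geomWeight_le (Λ := lam) (Ξ := fun u => ζ * xi u) hs.1 hL0 hε.le hM.le ha (hA s)
      (hInt hlam_int s hs.1) ((hInt hxi_int s hs.1).const_mul ζ) (hlamL s) (by
        filter_upwards [ae_restrict_mem measurableSet_Ioc] with u hu k
        exact Or.inr ⟨le_rfl, fun hk => mul_le_mul_of_nonneg_right (hz k hk) (hxi u hu.1.le)⟩)
      (hexp' s) F
  have hpnK : ∀ s ∈ Icc 0 t, ∀ F : Finset ℕ, ∑ k ∈ F, geomWeight ε k * pn s k ≤ K := by
    intro s hs F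
    -- For j ≤ n the mass stays in {0, ..., n}, where catastrophe rates are kept. For j > n it stays
    -- at j, and g(j) ≤ K because M ≥ 1.
    rcases le_or_gt j n with hj | hj
    · refine hpn''.sum_geomWeight_le (Λ := lam) (Ξ := fun u => ζ * xi u) hs.1 hL0 hε.le hM.le ha
        (hAn s) (hInt hlam_int s hs.1) ((hInt hxi_int s hs.1).const_mul ζ) (hlamL s) ?_
        (hexp' s) F
      filter_upwards [ae_restrict_mem measurableSet_Ioc] with u hu k
      rcases lt_or_ge n k with hk | hk
      · left
        rw [hpn.eq_of_lt_truncMatrix hu.1.le hk, unitVec_apply, if_neg (by omega)]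
      · right
        constructor
        · split_ifs
          · exact le_rfl
          · exact hlam u hu.1.le
        · intro hk1
          rw [if_pos hk]
          exact mul_le_mul_of_nonneg_right (hz k hk1) (hxi u hu.1.le)
    · have hnn := hpn''.nonneg hs.1 hL0 (hAn s)
      have hone := hpn''.hasSum_one hs.1 hL0 (hAn s)
      have hjj : pn s j = 1 := by
        rw [hpn.eq_of_lt_truncMatrix hs.1 hj, unitVec_apply, if_pos rfl]
      -- The coordinate j already carries the whole mass 1, and all the others are nonnegative.
      have hzero : ∀ k, k ≠ j → pn s k = 0 := fun k hk => by
        have h1 := sum_le_hasSum {k, j} (fun i _ => hnn i) hone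
        rw [Finset.sum_pair hk, hjj] at h1
        linarith [hnn k]
      calc ∑ k ∈ F, geomWeight ε k * pn s k
          ≤ ∑ k ∈ F, if k = j then geomWeight ε j else 0 := by
            refine Finset.sum_le_sum fun k _ => ?_
            split_ifs with hk
            · rw [hk, hjj, mul_one]
            · rw [hzero k hk, mul_zero]
        _ ≤ geomWeight ε j := by
            rw [Finset.sum_ite_eq']
            split_ifs
            · exact le_rfl
            · exact geomWeight_nonneg hε.le j
        _ ≤ j * (1 + ε) ^ (j + 1) := geomWeight_le hε.le j
        _ ≤ M * (j * (1 + ε) ^ (j + 1)) := le_mul_of_one_le_left (by positivity) hM1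
        _ ≤ K := by
            rw [hK, mul_assoc]
            exact le_add_of_nonneg_right (by positivity)
  obtain ⟨hW, hWg⟩ := truncWeight_pos_and_mul_le hε.le hn
  obtain ⟨h1, h2, h3, h4⟩ := truncation_error_le hp' hpn' ht hL0 hn hW (hA t)
    (le_geomWeight hε.le) hWg hpK hpnK
  refine ⟨h1.trans ?_, h2, h3, h4⟩
  have hK0 : 0 ≤ K := by positivity
  gcongr
  norm_num
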